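/- A parliamentary election consists of a set $C$ of $m\ge 2$ parties, $n\ge 1$ voters, and a sequence $\mathcal O=(O_1,\dots,O_n)$ of preference orders (linear orders of $C$). In a sequence of orders $\mathcal O$, a party $c$ receives $\mathrm{Borda}(\mathcal O,c)=\sum_{i=1}^n (m-\mathrm{pos}(O_i,c))$ points, where $\mathrm{pos}(O_i,c)\in\{1,\dots,m\}$ is the position of $c$ in $O_i$ ($1$ is the top). Without threshold, a set $S\subseteq C$ of parties gets the fraction of seats $\mathrm{seats}(\mathcal O,S)=\sum_{c\in S}\mathrm{Borda}(\mathcal O,c)\big/\sum_{c\in C}\mathrm{Borda}(\mathcal O,c)$. The problem Borda$_0$-CBP (coalition bribery with a preferred party, Borda scoring, no threshold) is the following. Given an election, a coalition $A\subseteq C$, a preferred party $c_1\in A$, a budget $B\in\mathbb N$, rational numbers $\varphi,\rho\in[0,1]$ and a bribery type with its prices, decide whether there are orders $\hat{\mathcal O}=(\hat O_1,\dots,\hat O_n)$, obtained from $\mathcal O$ by permissible changes, such that (a) the total cost $\sum_{i=1}^n\pi_i(O_i,\hat O_i)$ is at most $B$; (b) $\mathrm{seats}(\hat{\mathcal O},A)\ge\varphi\cdot\mathrm{seats}(\hat{\mathcal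 O},C)$; (c) $\mathrm{seats}(\hat{\mathcal O},\{c_1\})\ge\rho\cdot\mathrm{seats}(\hat{\mathcal O},A)$. The bribery types considered are: - $1$-bribery: every change is permissible, and $\pi_i(O_i,\hat O_i)=1$ if $\hat O_i\ne O_i$, and $0$ otherwise. - $\$$-bribery: every change is permissible, and $\pi_i(O_i,\hat O_i)=p_i$ if $\hat O_i\ne O_i$, and $0$ otherwise, for given prices $p_i\in\mathbb N$. - coalition-shift-bribery: a change of $O_i$ to $\hat O_i$ is permissible if there are no $x\in A$ and $y\notin A$ with $x$ above $y$ in $O_i$ but below $y$ in $\hat O_i$; its cost is $s_i(k)$, where $k$ is the number of pairs $(x,y)$ of parties with $y$ below $x$ in $O_i$ and above $x$ in $\hat O_i$, for given monotone functions $s_i:\{0,\dots,m(m-1)/2\}\to\mathbb N$, each listed by its values. **Theorem.** For each of $1$-bribery, $\$$-bribery and coalition-shift-bribery, Borda$_0$-CBP can be solved in polynomial time: there are a deterministic algorithm and a polynomial $q$ such that the algorithm decides every instance correctly within $q(L)$ steps, where $L$ is the length of the instance when it is written as a list of natural numbers in binary. (Steps are counted on a random access machine with unit-cost addition and truncated subtraction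 and no multiplication, which is polynomially equivalent to Turing machines.) -/

import Mathlib

open scoped BigOperators

/-! ## Machine model: random access programs with unit-cost addition

Memory consists of natural-number variables and natural-number arrays; a program mentions only
finitely many of each. The arithmetic is addition and truncated subtraction (no multiplication),
and every evaluated node of an expression and every executed command costs one time unit. Since an
operation lengthens the largest stored number by at most one bit, `T` steps of such a program are
simulated by a Turing machine in time polynomial in `T` and in the bit length of the input, so
polynomial time in this model is the usual polynomial time. -/

namespace RAM

/-- Memory: `reg x` is the variable number `x`, and `arr a i` is the cell `i` of array number `a`. -/
structure Memory where
  reg : ℕ → ℕ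
  arr : ℕ → ℕ → ℕ

/-- Expressions: constants, variables, array cells, sum, truncated difference. -/
inductive Expr where
  | const (n : ℕ)
  | reg (x : ℕ)
  | cell (a : ℕ) (index : Expr)
  | sum (e f : Expr)
  | diff (e f : Expr)

/-- Value of an expression. -/
def Expr.eval (s : Memory) : Expr → ℕ
  | .const n => n
  | .reg x => s.reg x
  | .cell a i => s.arr a (i.eval s)
  | .sum e f => e.eval s + f.eval s
  | .diff e f => e.eval s - f.eval s

/-- Time to evaluate an expression: its number of nodes. -/
def Expr.cost : Expr → ℕ
  | .const _ => 1
  | .reg _ => 1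
  | .cell _ i => i.cost + 1
  | .sum e f => e.cost + f.cost + 1
  | .diff e f => e.cost + f.cost + 1

/-- Programs. The conditions of `ite` and `loop` (a while loop) hold when the value is nonzero. -/
inductive Prog where
  | skip
  | assign (x : ℕ) (e : Expr)
  | store (a : ℕ) (index : Expr) (e : Expr)
  | seq (p q : Prog)
  | ite (e : Expr) (p q : Prog)
  | loop (e : Expr) (p : Prog)

/-- The memory after the assignment `x := v`. -/
def Memory.setReg (s : Memory) (x v : ℕ) : Memory :=
  { s with reg := Function.update s.reg x v }

/-- The memory after the assignment `a[i] := v`. -/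
def Memory.setCell (s : Memory) (a i v : ℕ) : Memory :=
  { s with arr := Function.update s.arr a (Function.update (s.arr a) i v) }

/-- `Run p s t s'`: program `p`, started in memory `s`, halts after exactly `t` time units
with memory `s'`. -/
inductive Run : Prog → Memory → ℕ → Memory → Prop where
  | skip (s : Memory) : Run .skip s 1 s
  | assign (s : Memory) (x : ℕ) (e : Expr) :
      Run (.assign x e) s (e.cost + 1) (s.setReg x (e.eval s))
  | store (s : Memory) (a : ℕ) (i e : Expr) :
      Run (.store a i e) s (i.cost + e.cost + 1) (s.setCell a (i.eval s) (e.eval s))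
  | seq {p q : Prog} {s s₁ s₂ : Memory} {t₁ t₂ : ℕ} :
      Run p s t₁ s₁ → Run q s₁ t₂ s₂ → Run (.seq p q) s (t₁ + t₂) s₂
  | ite_true {e : Expr} {p q : Prog} {s s' : Memory} {t : ℕ} :
      e.eval s ≠ 0 → Run p s t s' → Run (.ite e p q) s (e.cost + 1 + t) s'
  | ite_false {e : Expr} {p q : Prog} {s s' : Memory} {t : ℕ} :
      e.eval s = 0 → Run q s t s' → Run (.ite e p q) s (e.cost + 1 + t) s'
  | loop_halt {e : Expr} {p : Prog} {s : Memory} :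
      e.eval s = 0 → Run (.loop e p) s (e.cost + 1) s
  | loop_step {e : Expr} {p : Prog} {s s₁ s₂ : Memory} {t₁ t₂ : ℕ} :
      e.eval s ≠ 0 → Run p s t₁ s₁ → Run (.loop e p) s₁ t₂ s₂ →
      Run (.loop e p) s (e.cost + 1 + t₁ + t₂) s₂

/-- The model is deterministic: the result and the running time are determined by the input. -/
theorem Run.deterministic {p : Prog} {s s₁ s₂ : Memory} {t₁ t₂ : ℕ}
    (h₁ : Run p s t₁ s₁) (h₂ : Run p s t₂ s₂) : t₁ = t₂ ∧ s₁ = s₂ := by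
  induction h₁ generalizing t₂ s₂ with
  | skip s => cases h₂; exact ⟨rfl, rfl⟩
  | assign s x e => cases h₂; exact ⟨rfl, rfl⟩
  | store s a i e => cases h₂; exact ⟨rfl, rfl⟩
  | seq _ _ ih₁ ih₂ =>
      cases h₂ with
      | seq a b =>
          obtain ⟨rfl, rfl⟩ := ih₁ a
          obtain ⟨rfl, rfl⟩ := ih₂ b
          exact ⟨rfl, rfl⟩
  | ite_true h _ ih =>
      cases h₂ with
      | ite_true _ a => obtain ⟨rfl, rfl⟩ := ih a; exact ⟨rfl, rfl⟩
      | ite_false h' _ => exact absurd h' h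
  | ite_false h _ ih =>
      cases h₂ with
      | ite_true h' _ => exact absurd h h'
      | ite_false _ a => obtain ⟨rfl, rfl⟩ := ih a; exact ⟨rfl, rfl⟩
  | loop_halt h =>
      cases h₂ with
      | loop_halt _ => exact ⟨rfl, rfl⟩
      | loop_step h' _ _ => exact absurd h h'
  | loop_step h _ _ ih₁ ih₂ =>
      cases h₂ with
      | loop_halt h' => exact absurd h' h
      | loop_step _ a b =>
          obtain ⟨rfl, rfl⟩ := ih₁ a
          obtain ⟨rfl, rfl⟩ := ih₂ b
          exact ⟨rfl, rfl⟩

/-- Initial memory: array `0` holds the input numbers, variable `0` holds how many there are,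
and everything else is `0`. -/
def Memory.init (w : List ℕ) : Memory where
  reg x := if x = 0 then w.length else 0
  arr a i := if a = 0 then w.getD i 0 else 0

/-- Size of the input: the total length of the binary expansions, plus one separator each. -/
def bitLength (w : List ℕ) : ℕ := (w.map fun k => k.size + 1).sum

/-- The decision problem `Yes`, on instances of type `α` encoded by `enc`, is solvable in polynomial
time: one program halts on every instance within a number of steps that is polynomial in the
bit length of the encoding, with `1` in variable `0` on yes-instances and `0` on no-instances. -/
def SolvableInPolyTime {α : Type} (enc : α → List ℕ) (Yes : α → Prop) : Prop :=
  ∃ (p : Prog) (time : Polynomial ℕ), ∀ x : α, ∃ (t : ℕ) (s : Memory),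
    Run p (Memory.init (enc x)) t s ∧ t ≤ time.eval (bitLength (enc x)) ∧
    (Yes x → s.reg 0 = 1) ∧ (¬ Yes x → s.reg 0 = 0)

end RAM

/-! ## Elections, seats and bribery -/

namespace CoalitionBribery

/-- A preference order over the parties `Fin m`, as the bijection that sends each party to its
place, where place `0` is the top. -/
abbrev Pref (m : ℕ) : Type := Fin m ≃ Fin m

/-- The position of party `c` in the order `O`, from `1` (top) to `m` (bottom). -/
def pos {m : ℕ} (O : Pref m) (c : Fin m) : ℕ := (O c : ℕ) + 1

/-- Borda score of a party in one order. -/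
def borda {m : ℕ} (O : Pref m) (c : Fin m) : ℚ := (m : ℚ) - pos O c

section Seats

variable {m n : ℕ} (γ : Pref m → Fin m → ℚ) (t : ℚ) (O : Fin n → Pref m)

/-- Points given by the sequence of orders `O` to the set of parties `S`. -/
def points (S : Finset (Fin m)) : ℚ := ∑ i, ∑ c ∈ S, γ (O i) c

/-- A party is active unless it gets less than a fraction `t` of all the points. -/
def Active (c : Fin m) : Prop := ¬ points γ O {c} < t * points γ O Finset.univ

instance (c : Fin m) : Decidable (Active γ t O c) :=
  inferInstanceAs (Decidable (¬ points γ O {c} < t * points γ O Finset.univ))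

/-- Fraction of seats of one party, with scoring function `γ` and threshold `t`. -/
def partySeats (c : Fin m) : ℚ :=
  if Active γ t O c then
    points γ O {c} / points γ O (Finset.univ.filter fun c' => Active γ t O c')
  else 0

/-- Fraction of seats of a set of parties. -/
def seats (S : Finset (Fin m)) : ℚ := ∑ c ∈ S, partySeats γ t O c

end Seats

/-- The data of the problem CBP apart from the prices: an election with `m` parties and `n` voters,
the coalition, the preferred party, the budget, the target support and the target ratio. -/
structure Base where
  m : ℕ
  n : ℕ
  two_le_m : 2 ≤ m
  one_le_n : 1 ≤ n
  /-- the preference orders of the voters -/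
  orders : Fin n → Pref m
  /-- the coalition -/
  A : Finset (Fin m)
  /-- the preferred party -/
  c₁ : Fin m
  c₁_mem : c₁ ∈ A
  budget : ℕ
  /-- the target support -/
  φ : ℚ
  φ_nonneg : 0 ≤ φ
  φ_le_one : φ ≤ 1
  /-- the target ratio -/
  ρ : ℚ
  ρ_nonneg : 0 ≤ ρ
  ρ_le_one : ρ ≤ 1

/-- The question of CBP for the scoring function `γ`, the threshold `t`, the permissible changes
`ok i O O'` and the prices `π i O O'` of replacing the order `O` of voter `i` by `O'`. -/
def CBP (I : Base) (γ : Pref I.m → Fin I.m → ℚ) (t : ℚ)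
    (ok : Fin I.n → Pref I.m → Pref I.m → Prop)
    (π : Fin I.n → Pref I.m → Pref I.m → ℕ) : Prop :=
  ∃ O' : Fin I.n → Pref I.m,
    (∀ i, ok i (I.orders i) (O' i)) ∧
    ∑ i, π i (I.orders i) (O' i) ≤ I.budget ∧
    seats γ t O' I.A ≥ I.φ * seats γ t O' Finset.univ ∧
    seats γ t O' {I.c₁} ≥ I.ρ * seats γ t O' I.A

/-- An instance with `$`-bribery prices: `price i` is the price of changing the order of voter `i`. -/
structure DollarInstance extends Base where
  price : Fin n → ℕ

/-- The ordered pairs `(x, y)` of parties with `y` below `x` in `O` and above `x` in `O'`. -/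
def swapped {m : ℕ} (O O' : Pref m) : Finset (Fin m × Fin m) :=
  Finset.univ.filter fun q => pos O q.1 < pos O q.2 ∧ pos O' q.2 < pos O' q.1

theorem card_swapped_le {m : ℕ} (O O' : Pref m) : (swapped O O').card ≤ m.choose 2 := by
  classical
  have h : (swapped O O').card ≤ (Finset.powersetCard 2 (Finset.univ : Finset (Fin m))).card := by
    refine Finset.card_le_card_of_injOn (fun q => {q.1, q.2}) ?_ ?_
    · rintro ⟨x, y⟩ hq
      simp only [swapped, Finset.coe_filter, Finset.mem_univ, true_and, Set.mem_ofPred_eq] at hq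
      have hne : x ≠ y := by rintro rfl; exact lt_irrefl _ hq.1
      simp [Finset.mem_powersetCard, Finset.card_pair hne]
    · rintro ⟨x, y⟩ hq ⟨z, w⟩ hr he
      replace he : ({x, y} : Finset (Fin m)) = {z, w} := he
      simp only [swapped, Finset.coe_filter, Finset.mem_univ, true_and, Set.mem_ofPred_eq] at hq hr
      have hx : x = z ∨ x = w := by
        have : x ∈ ({z, w} : Finset (Fin m)) := by rw [← he]; simp
        simpa using this
      have hy : y = z ∨ y = w := by
        have : y ∈ ({z, w} : Finset (Fin m)) := by rw [← he]; simp
        simpa using this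
      rcases hx with rfl | rfl <;> rcases hy with rfl | rfl
      · omega
      · rfl
      · omega
      · omega
  simpa using h

/-- An instance with coalition-shift-bribery prices: `shiftPrice i k` is the price of `k` swapped
pairs at voter `i`, a monotone function of `k ∈ {0, …, m(m-1)/2}`. -/
structure ShiftInstance extends Base where
  shiftPrice : Fin n → Fin (m.choose 2 + 1) → ℕ
  shiftPrice_mono : ∀ i, Monotone (shiftPrice i)

/-- The CBP question for Borda without threshold and `1`-bribery: all changes are permissible, and
changing the order of a voter costs `1`. -/
def OneBordaCBP (I : Base) : Prop :=
  CBP I borda 0 (fun _ _ _ => True) (fun _ O O' => if O' = O then 0 else 1)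

/-- The CBP question for Borda without threshold and `$`-bribery: all changes are permissible, and
changing the order of voter `i` costs `price i`. -/
def DollarBordaCBP (I : DollarInstance) : Prop :=
  CBP I.toBase borda 0 (fun _ _ _ => True) (fun i O O' => if O' = O then 0 else I.price i)

/-- The CBP question for Borda without threshold and coalition-shift-bribery: no party of the
coalition may fall below a party outside the coalition that it was above, and the price is a
monotone function of the number of swapped pairs. -/
def ShiftBordaCBP (I : ShiftInstance) : Prop :=
  CBP I.toBase borda 0
    (fun _ O O' => ∀ x ∈ I.A, ∀ y ∉ I.A, ¬ (pos O x < pos O y ∧ pos O' y < pos O' x))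
    (fun i O O' => I.shiftPrice i ⟨(swapped O O').card, Nat.lt_succ_of_le (card_swapped_le O O')⟩)

/-! ## Encodings of the instances as lists of natural numbers -/

/-- Numbers of parties and voters, budget, numerators and denominators of the targets, preferred
party, indicator of the coalition, and the orders, each listed from the top party to the bottom. -/
def Base.encode (I : Base) : List ℕ :=
  [I.m, I.n, I.budget, I.φ.num.toNat, I.φ.den, I.ρ.num.toNat, I.ρ.den, (I.c₁ : ℕ)] ++
  List.ofFn (fun c : Fin I.m => if c ∈ I.A then 1 else 0) ++
  (List.ofFn fun i : Fin I.n =>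
    List.ofFn fun r : Fin I.m => (((I.orders i).symm r : Fin I.m) : ℕ)).flatten

def DollarInstance.encode (I : DollarInstance) : List ℕ :=
  I.toBase.encode ++ List.ofFn I.price

def ShiftInstance.encode (I : ShiftInstance) : List ℕ :=
  I.toBase.encode ++ (List.ofFn fun i : Fin I.n => List.ofFn (I.shiftPrice i)).flatten

end CoalitionBribery

/-! ## Expressions with bounded sums and maxima, compiled to random access programs -/

namespace RAM

/-! Without threshold every party is active, and every order distributes exactly `m.choose 2`
points. The two targets are therefore linear inequalities in two totals: the points `a` of the
coalition and the points `b` of the preferred party (`cbp_iff_swapCBP`). In all three bribery types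
the price at a voter is a monotone function of the number `k` of swapped pairs; for `1`- and
`$`-bribery this is because `k = 0` holds exactly for the unchanged order (`card_swapped_eq_zero`).
A voter thus matters only through the attainable triples of coalition points, preferred points and
swaps, all polynomially bounded. A dynamic program over the voters, which records the largest
remaining budget for each pair of totals, decides the instance (`swapCBP_iff`).

It remains to find the attainable triples of one voter. If two parties of the same kind, both in the
coalition but not preferred or both outside it, are inverted, then exchanging them keeps both
scores, keeps permissibility and strictly lowers the number of swaps. So only orders matter in which
each of these two kinds stays in its old order (`exists_sorted`). Such an order, built from the top,
is a merge of two queues with the preferred party inserted somewhere. The set of parties placed so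
far is determined by how far each queue has been read and whether the preferred party is in. `Feas`
is reachability in this state space, and `feas_of_sorted` and `exists_order_of_feas` are the two
directions of the correspondence with orders.

For the running time, a small language with sums and maxima below a bound is compiled to programs
whose time is polynomial in that bound (`Ex.run_compile`). If `N₀` is the length of the input list,
then `M = N₀ ^ 3` exceeds every total and `M ^ 6` bounds all table indices. Indices are numbers in
base `M`, so their order is lexicographic and each table entry depends on earlier entries only.
Budget, prices, and the numerators and denominators of the targets may be huge, but they occur only
in comparisons, sums, differences and as first factors of products, and never control a loop. -/

@[simp] theorem Memory.setReg_reg_self (s : Memory) (x v : ℕ) : (s.setReg x v).reg x = v := by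
  simp [Memory.setReg]

theorem Memory.setReg_reg_of_ne (s : Memory) {x y : ℕ} (v : ℕ) (h : y ≠ x) :
    (s.setReg x v).reg y = s.reg y := by
  simp [Memory.setReg, h]

@[simp] theorem Memory.setReg_arr (s : Memory) (x v : ℕ) : (s.setReg x v).arr = s.arr := rfl

@[simp] theorem Memory.setCell_reg (s : Memory) (a i v : ℕ) : (s.setCell a i v).reg = s.reg := rfl

/-- Expressions with multiplication, case distinction, local variables, and sums and maxima over
the numbers below the bound, which is kept in variable `0`. -/
inductive Ex where
  | const (n : ℕ)
  | bound
  | var (x : ℕ)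
  | cell (a : ℕ) (e : Ex)
  | add (e f : Ex)
  | sub (e f : Ex)
  | mul (e f : Ex)
  | cond (c e f : Ex)
  | bind (x : ℕ) (e f : Ex)
  | bsum (x : ℕ) (e : Ex)
  | bmax (x : ℕ) (e : Ex)

/-- Value of an expression for the bound `N`. The second factor of a product is capped at `N`. -/
def Ex.eval (N : ℕ) (arr : ℕ → ℕ → ℕ) : Ex → (ℕ → ℕ) → ℕ
  | .const n, _ => n
  | .bound, _ => N
  | .var x, v => v x
  | .cell a e, v => arr a (e.eval N arr v)
  | .add e f, v => e.eval N arr v + f.eval N arr v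
  | .sub e f, v => e.eval N arr v - f.eval N arr v
  | .mul e f, v => e.eval N arr v * min (f.eval N arr v) N
  | .cond c e f, v => if c.eval N arr v = 0 then f.eval N arr v else e.eval N arr v
  | .bind x e f, v => f.eval N arr (Function.update v x (e.eval N arr v))
  | .bsum x e, v => ∑ i ∈ Finset.range N, e.eval N arr (Function.update v x i)
  | .bmax x e, v => (Finset.range N).sup fun i => e.eval N arr (Function.update v x i)

/-- Run `p` for each value of variable `x` below the bound. -/
def forLoop (x : ℕ) (p : Prog) : Prog :=
  .seq (.assign x (.const 0))
    (.loop (.diff (.reg 0) (.reg x)) (.seq p (.assign x (.sum (.reg x) (.const 1)))))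

/-- The program that puts the value of an expression into variable `d`. Variable `x` of the
expression is kept in variable `ρ x`; the variables from `d` on are used as temporaries. -/
def Ex.compile : Ex → (ℕ → ℕ) → ℕ → Prog
  | .const n, _, d => .assign d (.const n)
  | .bound, _, d => .assign d (.reg 0)
  | .var x, ρ, d => .assign d (.reg (ρ x))
  | .cell a e, ρ, d => .seq (e.compile ρ d) (.assign d (.cell a (.reg d)))
  | .add e f, ρ, d => .seq (e.compile ρ d)
      (.seq (f.compile ρ (d + 1)) (.assign d (.sum (.reg d) (.reg (d + 1)))))
  | .sub e f, ρ, d => .seq (e.compile ρ d)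
      (.seq (f.compile ρ (d + 1)) (.assign d (.diff (.reg d) (.reg (d + 1)))))
  | .mul e f, ρ, d => .seq (e.compile ρ (d + 1)) (.seq (f.compile ρ (d + 2))
      (.seq (.assign d (.const 0)) (forLoop (d + 3)
        (.ite (.diff (.reg (d + 2)) (.reg (d + 3)))
          (.assign d (.sum (.reg d) (.reg (d + 1)))) .skip))))
  | .cond c e f, ρ, d => .seq (c.compile ρ d) (.ite (.reg d) (e.compile ρ d) (f.compile ρ d))
  | .bind x e f, ρ, d => .seq (e.compile ρ d)
      (.seq (f.compile (Function.update ρ x d) (d + 1)) (.assign d (.reg (d + 1))))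
  | .bsum x e, ρ, d => .seq (.assign d (.const 0)) (forLoop (d + 1)
      (.seq (e.compile (Function.update ρ x (d + 1)) (d + 2))
        (.assign d (.sum (.reg d) (.reg (d + 2))))))
  | .bmax x e, ρ, d => .seq (.assign d (.const 0)) (forLoop (d + 1)
      (.seq (e.compile (Function.update ρ x (d + 1)) (d + 2))
        -- With truncated subtraction, `p + (q - p)` is the maximum of `p` and `q`.
        (.assign d (.sum (.reg d) (.diff (.reg (d + 2)) (.reg d))))))

/-- Time bound for a loop, from the time bound for its body. -/
noncomputable def loopTime (T : Polynomial ℕ) : Polynomial ℕ :=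
  Polynomial.X * (T + 8) + 6

/-- Bound for the running time of the compiled expression, in terms of the bound. -/
noncomputable def Ex.time : Ex → Polynomial ℕ
  | .const _ => 2
  | .bound => 2
  | .var _ => 2
  | .cell _ e => e.time + 3
  | .add e f => e.time + f.time + 4
  | .sub e f => e.time + f.time + 4
  | .mul e f => e.time + f.time + 2 + loopTime 8
  | .cond c e f => c.time + 2 + e.time + f.time
  | .bind _ e f => e.time + f.time + 2
  | .bsum _ e => 2 + loopTime (e.time + 4)
  | .bmax _ e => 2 + loopTime (e.time + 6)

/-- A round costs 4 for the test and 4 for the increment besides the body; the 6 outside the rounds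
pays for the initial assignment and the failing last test. The induction is on the number of
remaining rounds. The body has to preserve the bound and the counter. -/
theorem run_forLoop {N T x : ℕ} {p : Prog} (hx : x ≠ 0) (Inv : ℕ → Memory → Prop)
    (step : ∀ i < N, ∀ s : Memory, s.reg 0 = N → s.reg x = i → Inv i s →
      ∃ t s', Run p s t s' ∧ t ≤ T ∧ s'.reg 0 = N ∧ s'.reg x = i ∧
        Inv (i + 1) (s'.setReg x (i + 1)))
    (s : Memory) (hN : s.reg 0 = N) (h0 : Inv 0 (s.setReg x 0)) :
    ∃ t s', Run (forLoop x p) s t s' ∧ t ≤ N * (T + 8) + 6 ∧ s'.reg 0 = N ∧ Inv N s' := by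
  have key : ∀ k i, i + k = N → ∀ s : Memory, s.reg 0 = N → s.reg x = i → Inv i s →
      ∃ t s', Run (.loop (.diff (.reg 0) (.reg x))
        (.seq p (.assign x (.sum (.reg x) (.const 1))))) s t s' ∧ t ≤ k * (T + 8) + 4 ∧
        s'.reg 0 = N ∧ Inv N s' := by
    intro k
    induction k with
    | zero =>
      intro i hi s hN hxi hI
      refine ⟨_, s, Run.loop_halt ?_, ?_, hN, ?_⟩
      · simp only [Expr.eval]; omega
      · simp [Expr.cost]
      · have : i = N := by omega
        exact this ▸ hI
    | succ k ih =>
      intro i hi s hN hxi hI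
      obtain ⟨t, s', hr, ht, hN', hxi', hI'⟩ := step i (by omega) s hN hxi hI
      obtain ⟨t₂, s₂, hr₂, ht₂, hN₂, hI₂⟩ := ih (i + 1) (by omega) (s'.setReg x (i + 1))
        (by rw [Memory.setReg_reg_of_ne _ _ hx.symm]; exact hN') (by simp) hI'
      have ha : Run (.assign x (.sum (.reg x) (.const 1))) s' 4 (s'.setReg x (i + 1)) := by
        have := Run.assign s' x (.sum (.reg x) (.const 1))
        simpa [Expr.eval, Expr.cost, hxi'] using this
      refine ⟨_, s₂, Run.loop_step ?_ (Run.seq hr ha) hr₂, ?_, hN₂, hI₂⟩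
      · simp only [Expr.eval]; omega
      · simp only [Expr.cost]
        have : (k + 1) * (T + 8) = k * (T + 8) + (T + 8) := by ring
        omega
  obtain ⟨t, s', hr, ht, h⟩ := key N 0 (by omega) (s.setReg x 0)
    (by rw [Memory.setReg_reg_of_ne _ _ hx.symm]; exact hN) (by simp) h0
  refine ⟨_, s', Run.seq (Run.assign s x (.const 0)) hr, ?_, h⟩
  simp only [Expr.cost]; omega

@[simp] theorem eval_loopTime (T : Polynomial ℕ) (N : ℕ) :
    (loopTime T).eval N = N * (T.eval N + 8) + 6 := by
  simp [loopTime]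

theorem run_assign_eq {s : Memory} {x v t : ℕ} {e : Expr} (hv : e.eval s = v)
    (ht : e.cost + 1 = t) : Run (.assign x e) s t (s.setReg x v) := by
  subst hv ht; exact Run.assign s x e

/-- Everything the expression reads lives in registers below `d`, and the compiled code writes only
from `d` on, so a subexpression compiled with a larger `d` leaves earlier partial results intact.
The time depends on `N` alone, since every loop makes exactly `N` rounds whatever the values are. -/
theorem Ex.run_compile (N : ℕ) (e : Ex) : ∀ (ρ : ℕ → ℕ) (d : ℕ) (v : ℕ → ℕ) (s : Memory),
    s.reg 0 = N → 0 < d → (∀ x, ρ x < d) → (∀ x, s.reg (ρ x) = v x) →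
    ∃ t s', Run (e.compile ρ d) s t s' ∧ t ≤ e.time.eval N ∧ s'.arr = s.arr ∧
      (∀ y < d, s'.reg y = s.reg y) ∧ s'.reg d = e.eval N s.arr v := by
  induction e with
  | const n =>
    intro ρ d v s hN hd hρ hv
    exact ⟨_, _, Run.assign _ _ _, by simp [Ex.time, Expr.cost], rfl,
      fun y hy => Memory.setReg_reg_of_ne _ _ hy.ne, by simp [Expr.eval, Ex.eval]⟩
  | bound =>
    intro ρ d v s hN hd hρ hv
    exact ⟨_, _, Run.assign _ _ _, by simp [Ex.time, Expr.cost], rfl,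
      fun y hy => Memory.setReg_reg_of_ne _ _ hy.ne, by simp [Expr.eval, Ex.eval, hN]⟩
  | var x =>
    intro ρ d v s hN hd hρ hv
    exact ⟨_, _, Run.assign _ _ _, by simp [Ex.time, Expr.cost], rfl,
      fun y hy => Memory.setReg_reg_of_ne _ _ hy.ne, by simp [Expr.eval, Ex.eval, hv]⟩
  | cell a e ih =>
    intro ρ d v s hN hd hρ hv
    obtain ⟨t, s', hr, ht, ha, hy, hd'⟩ := ih ρ d v s hN hd hρ hv
    refine ⟨_, _, Run.seq hr (Run.assign _ _ _), ?_, ha, fun y hyd => ?_, ?_⟩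
    · simp [Ex.time, Expr.cost]; omega
    · rw [Memory.setReg_reg_of_ne _ _ hyd.ne, hy y hyd]
    · simp [Expr.eval, Ex.eval, hd', ha]
  | add e f ihe ihf =>
    intro ρ d v s hN hd hρ hv
    obtain ⟨t, s₁, hr, ht, ha, hy, hd'⟩ := ihe ρ d v s hN hd hρ hv
    obtain ⟨t₂, s₂, hr₂, ht₂, ha₂, hy₂, hd₂⟩ := ihf ρ (d + 1) v s₁ (by rw [hy 0 hd, hN])
      (by omega) (fun x => (hρ x).trans (by omega)) (fun x => by rw [hy _ (hρ x), hv])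
    refine ⟨_, _, Run.seq hr (Run.seq hr₂ (Run.assign _ _ _)), ?_, by simp [ha, ha₂],
      fun y hyd => ?_, ?_⟩
    · simp [Ex.time, Expr.cost]; omega
    · rw [Memory.setReg_reg_of_ne _ _ hyd.ne, hy₂ y (by omega), hy y hyd]
    · simp [Expr.eval, Ex.eval, hd₂, ha, hy₂ d (by omega), hd']
  | sub e f ihe ihf =>
    intro ρ d v s hN hd hρ hv
    obtain ⟨t, s₁, hr, ht, ha, hy, hd'⟩ := ihe ρ d v s hN hd hρ hv
    obtain ⟨t₂, s₂, hr₂, ht₂, ha₂, hy₂, hd₂⟩ := ihf ρ (d + 1) v s₁ (by rw [hy 0 hd, hN])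
      (by omega) (fun x => (hρ x).trans (by omega)) (fun x => by rw [hy _ (hρ x), hv])
    refine ⟨_, _, Run.seq hr (Run.seq hr₂ (Run.assign _ _ _)), ?_, by simp [ha, ha₂],
      fun y hyd => ?_, ?_⟩
    · simp [Ex.time, Expr.cost]; omega
    · rw [Memory.setReg_reg_of_ne _ _ hyd.ne, hy₂ y (by omega), hy y hyd]
    · simp [Expr.eval, Ex.eval, hd₂, ha, hy₂ d (by omega), hd']
  | mul e f ihe ihf =>
    intro ρ d v s hN hd hρ hv
    obtain ⟨t, s₁, hr, ht, ha, hy, hd'⟩ := ihe ρ (d + 1) v s hN (by omega)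
      (fun x => (hρ x).trans (by omega)) hv
    obtain ⟨t₂, s₂, hr₂, ht₂, ha₂, hy₂, hd₂⟩ := ihf ρ (d + 2) v s₁ (by rw [hy 0 (by omega), hN])
      (by omega) (fun x => (hρ x).trans (by omega))
      (fun x => by rw [hy _ ((hρ x).trans (by omega)), hv])
    set E := e.eval N s.arr v with hE
    set F := f.eval N s.arr v with hF
    have h1 : s₂.reg (d + 1) = E := by rw [hy₂ _ (by omega), hd']
    have h2 : s₂.reg (d + 2) = F := by rw [hd₂, ha]
    obtain ⟨t₃, s₃, hr₃, ht₃, hN₃, hI⟩ := run_forLoop (N := N) (T := 8) (x := d + 3)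
      (p := .ite (.diff (.reg (d + 2)) (.reg (d + 3)))
          (.assign d (.sum (.reg d) (.reg (d + 1)))) .skip) (by omega)
      -- Multiplication is repeated addition: `E` is added in the rounds `i < F`. As there are only
      -- `N` rounds, the second factor is capped at `N`.
      (fun i s' => s'.arr = s.arr ∧ (∀ y < d, s'.reg y = s.reg y) ∧ s'.reg d = E * min F i ∧
        s'.reg (d + 1) = E ∧ s'.reg (d + 2) = F)
      (by
        rintro i hi s' hN' hx ⟨ia, iy, id, i1, i2⟩
        by_cases hc : i < F
        · refine ⟨_, _, Run.ite_true ?_ (Run.assign _ _ _), ?_, ?_, ?_, ?_, ?_, ?_, ?_, ?_⟩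
          · simp only [Expr.eval]; omega
          · simp [Expr.cost]
          · rw [Memory.setReg_reg_of_ne _ _ (by omega), hN']
          · rw [Memory.setReg_reg_of_ne _ _ (by omega), hx]
          · simp [ia]
          · intro y hyd
            rw [Memory.setReg_reg_of_ne _ _ (by omega), Memory.setReg_reg_of_ne _ _ (by omega),
              iy y hyd]
          · rw [Memory.setReg_reg_of_ne _ _ (by omega)]
            simp only [Memory.setReg_reg_self, Expr.eval, id, i1]
            rw [min_eq_right hc.le, min_eq_right (by omega)]; ring
          · rw [Memory.setReg_reg_of_ne _ _ (by omega), Memory.setReg_reg_of_ne _ _ (by omega), i1]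
          · rw [Memory.setReg_reg_of_ne _ _ (by omega), Memory.setReg_reg_of_ne _ _ (by omega), i2]
        · refine ⟨_, _, Run.ite_false ?_ (Run.skip _), ?_, hN', hx, ?_, ?_, ?_, ?_, ?_⟩
          · simp only [Expr.eval]; omega
          · simp [Expr.cost]
          · simp [ia]
          · intro y hyd
            rw [Memory.setReg_reg_of_ne _ _ (by omega), iy y hyd]
          · rw [Memory.setReg_reg_of_ne _ _ (by omega), id, min_eq_left (by omega),
              min_eq_left (by omega)]
          · rw [Memory.setReg_reg_of_ne _ _ (by omega), i1]
          · rw [Memory.setReg_reg_of_ne _ _ (by omega), i2])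
      (s₂.setReg d 0) (by rw [Memory.setReg_reg_of_ne _ _ (by omega), hy₂ _ (by omega),
        hy _ (by omega), hN])
      ⟨by simp [ha, ha₂], fun y hyd => by
        rw [Memory.setReg_reg_of_ne _ _ (by omega), Memory.setReg_reg_of_ne _ _ (by omega),
          hy₂ y (by omega), hy y (by omega)], by
        rw [Memory.setReg_reg_of_ne _ _ (by omega)]; simp, by
        rw [Memory.setReg_reg_of_ne _ _ (by omega), Memory.setReg_reg_of_ne _ _ (by omega), h1], by
        rw [Memory.setReg_reg_of_ne _ _ (by omega), Memory.setReg_reg_of_ne _ _ (by omega), h2]⟩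
    refine ⟨_, s₃, Run.seq hr (Run.seq hr₂ (Run.seq (run_assign_eq rfl rfl) hr₃)), ?_, hI.1,
      hI.2.1, hI.2.2.1⟩
    simp only [Ex.time, Expr.cost, Polynomial.eval_add, eval_loopTime, Polynomial.eval_ofNat]
    omega
  | cond c e f ihc ihe ihf =>
    intro ρ d v s hN hd hρ hv
    obtain ⟨t, s₁, hr, ht, ha, hy, hd'⟩ := ihc ρ d v s hN hd hρ hv
    by_cases hc : c.eval N s.arr v = 0
    · obtain ⟨t₂, s₂, hr₂, ht₂, ha₂, hy₂, hd₂⟩ := ihf ρ d v s₁ (by rw [hy 0 hd, hN])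
        (by omega) hρ (fun x => by rw [hy _ (hρ x), hv])
      refine ⟨_, _, Run.seq hr (Run.ite_false (by simpa [Expr.eval, hd'] using hc) hr₂), ?_,
        by simp [ha, ha₂], fun y hyd => by rw [hy₂ y hyd, hy y hyd], by simp [Ex.eval, hc, hd₂, ha]⟩
      simp [Ex.time, Expr.cost]; omega
    · obtain ⟨t₂, s₂, hr₂, ht₂, ha₂, hy₂, hd₂⟩ := ihe ρ d v s₁ (by rw [hy 0 hd, hN])
        (by omega) hρ (fun x => by rw [hy _ (hρ x), hv])
      refine ⟨_, _, Run.seq hr (Run.ite_true (by simpa [Expr.eval, hd'] using hc) hr₂), ?_,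
        by simp [ha, ha₂], fun y hyd => by rw [hy₂ y hyd, hy y hyd], by simp [Ex.eval, hc, hd₂, ha]⟩
      simp [Ex.time, Expr.cost]; omega
  | bind x e f ihe ihf =>
    intro ρ d v s hN hd hρ hv
    obtain ⟨t, s₁, hr, ht, ha, hy, hd'⟩ := ihe ρ d v s hN hd hρ hv
    obtain ⟨t₂, s₂, hr₂, ht₂, ha₂, hy₂, hd₂⟩ := ihf (Function.update ρ x d) (d + 1)
      (Function.update v x (e.eval N s.arr v)) s₁ (by rw [hy 0 hd, hN])
      (by omega) (fun z => by
        by_cases hz : z = x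
        · subst hz; simp
        · have := hρ z
          simp only [Function.update_of_ne hz]
          omega)
      (fun z => by
        by_cases hz : z = x
        · subst hz; simp [hd']
        · simp [hz, hy _ (hρ z), hv])
    refine ⟨_, _, Run.seq hr (Run.seq hr₂ (Run.assign _ _ _)), ?_, by simp [ha, ha₂],
      fun y hyd => ?_, ?_⟩
    · simp [Ex.time, Expr.cost]; omega
    · rw [Memory.setReg_reg_of_ne _ _ hyd.ne, hy₂ y (by omega), hy y hyd]
    · simp [Expr.eval, Ex.eval, hd₂, ha]
  | bsum x e ih =>
    intro ρ d v s hN hd hρ hv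
    obtain ⟨t₃, s₃, hr₃, ht₃, hN₃, hI⟩ := run_forLoop (N := N) (T := e.time.eval N + 4)
      (x := d + 1)
      (p := .seq (e.compile (Function.update ρ x (d + 1)) (d + 2))
        (.assign d (.sum (.reg d) (.reg (d + 2))))) (by omega)
      (fun i s' => s'.arr = s.arr ∧ (∀ y < d, s'.reg y = s.reg y) ∧
        s'.reg d = ∑ j ∈ Finset.range i, e.eval N s.arr (Function.update v x j))
      (by
        rintro i hi s' hN' hx ⟨ia, iy, id⟩
        obtain ⟨t₂, s₂, hr₂, ht₂, ha₂, hy₂, hd₂⟩ := ih (Function.update ρ x (d + 1)) (d + 2)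
          (Function.update v x i) s' hN' (by omega) (fun z => by
            by_cases hz : z = x
            · subst hz; simp
            · have := hρ z
              simp only [Function.update_of_ne hz]
              omega)
          (fun z => by
            by_cases hz : z = x
            · subst hz; simp [hx]
            · simp [hz, iy _ (hρ z), hv])
        refine ⟨_, _, Run.seq hr₂ (Run.assign _ _ _), ?_, ?_, ?_, ?_, ?_, ?_⟩
        · simp [Expr.cost]; omega
        · rw [Memory.setReg_reg_of_ne _ _ (by omega), hy₂ _ (by omega), hN']
        · rw [Memory.setReg_reg_of_ne _ _ (by omega), hy₂ _ (by omega), hx]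
        · simp [ia, ha₂]
        · intro y hyd
          rw [Memory.setReg_reg_of_ne _ _ (by omega), Memory.setReg_reg_of_ne _ _ (by omega),
            hy₂ _ (by omega), iy y hyd]
        · rw [Memory.setReg_reg_of_ne _ _ (by omega)]
          simp only [Memory.setReg_reg_self, Expr.eval, hd₂, hy₂ d (by omega), id, ia,
            Finset.sum_range_succ])
      (s.setReg d 0) (by rw [Memory.setReg_reg_of_ne _ _ (by omega), hN])
      ⟨by simp, fun y hyd => by
        rw [Memory.setReg_reg_of_ne _ _ (by omega), Memory.setReg_reg_of_ne _ _ (by omega)], by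
        rw [Memory.setReg_reg_of_ne _ _ (by omega)]; simp⟩
    refine ⟨_, s₃, Run.seq (run_assign_eq rfl rfl) hr₃, ?_, hI.1, hI.2.1, hI.2.2⟩
    simp only [Ex.time, Expr.cost, Polynomial.eval_add, eval_loopTime, Polynomial.eval_ofNat]
    omega
  | bmax x e ih =>
    intro ρ d v s hN hd hρ hv
    obtain ⟨t₃, s₃, hr₃, ht₃, hN₃, hI⟩ := run_forLoop (N := N) (T := e.time.eval N + 6)
      (x := d + 1)
      (p := .seq (e.compile (Function.update ρ x (d + 1)) (d + 2))
        (.assign d (.sum (.reg d) (.diff (.reg (d + 2)) (.reg d))))) (by omega)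
      (fun i s' => s'.arr = s.arr ∧ (∀ y < d, s'.reg y = s.reg y) ∧
        s'.reg d = (Finset.range i).sup fun j => e.eval N s.arr (Function.update v x j))
      (by
        rintro i hi s' hN' hx ⟨ia, iy, id⟩
        obtain ⟨t₂, s₂, hr₂, ht₂, ha₂, hy₂, hd₂⟩ := ih (Function.update ρ x (d + 1)) (d + 2)
          (Function.update v x i) s' hN' (by omega) (fun z => by
            by_cases hz : z = x
            · subst hz; simp
            · have := hρ z
              simp only [Function.update_of_ne hz]
              omega)
          (fun z => by
            by_cases hz : z = x
            · subst hz; simp [hx]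
            · simp [hz, iy _ (hρ z), hv])
        refine ⟨_, _, Run.seq hr₂ (Run.assign _ _ _), ?_, ?_, ?_, ?_, ?_, ?_⟩
        · simp [Expr.cost]; omega
        · rw [Memory.setReg_reg_of_ne _ _ (by omega), hy₂ _ (by omega), hN']
        · rw [Memory.setReg_reg_of_ne _ _ (by omega), hy₂ _ (by omega), hx]
        · simp [ia, ha₂]
        · intro y hyd
          rw [Memory.setReg_reg_of_ne _ _ (by omega), Memory.setReg_reg_of_ne _ _ (by omega),
            hy₂ _ (by omega), iy y hyd]
        · rw [Memory.setReg_reg_of_ne _ _ (by omega)]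
          simp only [Memory.setReg_reg_self, Expr.eval, hd₂, hy₂ d (by omega), id, ia,
            Finset.range_add_one, Finset.sup_insert]
          omega)
      (s.setReg d 0) (by rw [Memory.setReg_reg_of_ne _ _ (by omega), hN])
      ⟨by simp, fun y hyd => by
        rw [Memory.setReg_reg_of_ne _ _ (by omega), Memory.setReg_reg_of_ne _ _ (by omega)], by
        rw [Memory.setReg_reg_of_ne _ _ (by omega)]; simp⟩
    refine ⟨_, s₃, Run.seq (run_assign_eq rfl rfl) hr₃, ?_, hI.1, hI.2.1, hI.2.2⟩
    simp only [Ex.time, Expr.cost, Polynomial.eval_add, eval_loopTime, Polynomial.eval_ofNat]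
    omega

/-- The environment in which variable `0` is `j` and all others are `0`. -/
def env (j : ℕ) : ℕ → ℕ := Function.update (fun _ => 0) 0 j

/-- The program `a[j] := e(j)` for all `j` below the bound, in increasing order. -/
def fill (a : ℕ) (e : Ex) : Prog :=
  forLoop 2 (.seq (e.compile (Function.update (fun _ => 1) 0 2) 3) (.store a (.reg 2) (.reg 3)))

/-- The hypothesis on `e` concerns any memory that is already correct below `j` and unchanged
outside array `a`; this is what lets a table be defined by recursion on its own earlier entries. All
variables of `e` except `0` are read from register `1`, which therefore has to hold `0`. -/
theorem run_fill {N a : ℕ} {e : Ex} (f : ℕ → ℕ) (s : Memory) (hN : s.reg 0 = N)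
    (h1 : s.reg 1 = 0)
    (h : ∀ j < N, ∀ arr : ℕ → ℕ → ℕ, (∀ a' ≠ a, arr a' = s.arr a') → (∀ j' < j, arr a j' = f j') →
      e.eval N arr (env j) = f j) :
    ∃ t s', Run (fill a e) s t s' ∧ t ≤ (loopTime (e.time + 3)).eval N ∧ s'.reg 0 = N ∧
      s'.reg 1 = 0 ∧ (∀ a' ≠ a, s'.arr a' = s.arr a') ∧ ∀ j < N, s'.arr a j = f j := by
  obtain ⟨t, s', hr, ht, hN', hI⟩ := run_forLoop (N := N) (T := e.time.eval N + 3) (x := 2)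
    (p := .seq (e.compile (Function.update (fun _ => 1) 0 2) 3) (.store a (.reg 2) (.reg 3)))
    (by omega)
    (fun i s' => s'.reg 1 = 0 ∧ (∀ a' ≠ a, s'.arr a' = s.arr a') ∧ ∀ j < i, s'.arr a j = f j)
    (by
      rintro i hi s' hN' hx ⟨i1, ia, iy⟩
      obtain ⟨t₂, s₂, hr₂, ht₂, ha₂, hy₂, hd₂⟩ := e.run_compile N
        (Function.update (fun _ => 1) 0 2) 3 (env i) s' hN' (by omega) (fun z => by
            by_cases hz : z = 0
            · subst hz; simp
            · simp [hz])
          (fun z => by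
            by_cases hz : z = 0
            · subst hz; simp [hx, env]
            · simp [hz, env, i1])
      rw [h i hi s'.arr ia iy] at hd₂
      refine ⟨_, _, Run.seq hr₂ (Run.store _ _ _ _), ?_, ?_, ?_, ?_, ?_, ?_⟩
      · simp [Expr.cost]; omega
      · simp [hy₂, hN']
      · simp [hy₂, hx]
      · rw [Memory.setReg_reg_of_ne _ _ (by omega)]; simp [hy₂, i1]
      · intro a' ha'
        simp [Memory.setCell, ha', ha₂, ia a' ha']
      · intro j hj
        simp only [Memory.setReg_arr, Memory.setCell, Expr.eval, Function.update_self, hd₂,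
          hy₂ 2 (by omega), hx]
        by_cases hji : j = i
        · subst hji; simp
        · simp [hji, ha₂, iy j (by omega)])
    s hN ⟨by rw [Memory.setReg_reg_of_ne _ _ (by omega), h1], fun _ _ => rfl, by simp⟩
  exact ⟨t, s', hr, by simpa using ht, hN', hI⟩

/-- The program that puts the value of a closed expression into variable `0`. -/
def assignBound (e : Ex) : Prog := .seq (e.compile (fun _ => 1) 2) (.assign 0 (.reg 2))

/-- Register `0` is both the loop bound and the output register, so the same program serves to
enlarge the bound and to return the answer. -/
theorem run_assignBound {N : ℕ} (e : Ex) (s : Memory) (hN : s.reg 0 = N) (h1 : s.reg 1 = 0) :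
    ∃ t s', Run (assignBound e) s t s' ∧ t ≤ (e.time + 2).eval N ∧
      s'.reg 0 = e.eval N s.arr (fun _ => 0) ∧ s'.reg 1 = 0 ∧ s'.arr = s.arr := by
  obtain ⟨t, s', hr, ht, ha, hy, hd⟩ := e.run_compile N (fun _ => 1) 2 (fun _ => 0) s hN
    (by omega) (by simp) (by simp [h1])
  refine ⟨_, _, Run.seq hr (Run.assign _ _ _), ?_, by simp [Expr.eval, hd], ?_, by simp [ha]⟩
  · simp [Expr.cost]; omega
  · rw [Memory.setReg_reg_of_ne _ _ (by omega), hy 1 (by omega), h1]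

end RAM

/-! ## Arrangements of the parties for one voter

The parties are named by their places in the old order, `ty z` tells the kind of the party in place
`z` (`0`: outside the coalition, `1`: in the coalition but not preferred, `2`: preferred), and
`g j` is the party in place `j` of the new order. -/

namespace CoalitionBribery

open Finset

section Voter

variable (m : ℕ) (ty : ℕ → ℕ) (strict : Prop)

/-- Coalition points of the first `r` places of the arrangement `g`. -/
def coalitionSum (g : ℕ → ℕ) (r : ℕ) : ℕ := ∑ j ∈ range r, if ty (g j) = 0 then 0 else m - 1 - j

/-- The points of the preferred party plus one, or `0` if it is not in the first `r` places. -/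
def preferredSum (g : ℕ → ℕ) (r : ℕ) : ℕ := ∑ j ∈ range r, if ty (g j) = 2 then m - j else 0

/-- Number of pairs that are swapped by the first `r` places of the arrangement `g`. -/
def swapSum (g : ℕ → ℕ) (r : ℕ) : ℕ := ∑ j ∈ range r, #(range (g j) \ (range j).image g)

/-- In the first `r` places of `g`, no party outside the coalition overtakes a coalition party. -/
def KeepsCoalition (g : ℕ → ℕ) (r : ℕ) : Prop :=
  ∀ j < r, ty (g j) = 0 → ∀ z < g j, ty z ≠ 0 → z ∈ (range j).image g

/-- The parties of kind `1` above `x`, those of kind `0` above `y`, and the preferred party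
unless `b` is `0`. -/
def placed (x y b : ℕ) : Finset ℕ :=
  (range m).filter fun z => (ty z = 1 ∧ z < x) ∨ (ty z = 0 ∧ z < y) ∨ (ty z = 2 ∧ b ≠ 0)

/-- The parties of `placed m ty x y b` can be arranged in the top places, each of the kinds `0` and
`1` in the old order, with `a` points for the coalition, `b - 1` for the preferred party and with
`k` swapped pairs. -/
inductive Feas : ℕ → ℕ → ℕ → ℕ → ℕ → Prop where
  | nil : Feas 0 0 0 0 0
  | skipMember {x y b a k : ℕ} : x < m → ty x ≠ 1 → Feas x y b a k → Feas (x + 1) y b a k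
  | skipOther {x y b a k : ℕ} : y < m → ty y ≠ 0 → Feas x y b a k → Feas x (y + 1) b a k
  | putMember {x y b a k : ℕ} : x < m → ty x = 1 → Feas x y b a k →
      Feas (x + 1) y b (a + (m - 1 - #(placed m ty x y b))) (k + #(range x \ placed m ty x y b))
  | putOther {x y b a k : ℕ} : y < m → ty y = 0 →
      (strict → ∀ z < y, ty z ≠ 0 → z ∈ placed m ty x y b) → Feas x y b a k →
      Feas x (y + 1) b a (k + #(range y \ placed m ty x y b))
  | putPreferred {x y a k : ℕ} (c : ℕ) : c < m → ty c = 2 → Feas x y 0 a k →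
      Feas x y (m - #(placed m ty x y 0)) (a + (m - 1 - #(placed m ty x y 0)))
        (k + #(range c \ placed m ty x y 0))

/-- The first `r` places of `g` hold the parties of `S`, with the given points and swaps. -/
structure Arrangement (g : ℕ → ℕ) (r : ℕ) (S : Finset ℕ) (a b k : ℕ) : Prop where
  image : (range r).image g = S
  card : #S = r
  coalition : coalitionSum m ty g r = a
  preferred : preferredSum m ty g r = b
  swap : swapSum g r = k
  keeps : strict → KeepsCoalition ty g r

variable {m ty strict}

/-- The new party gets place `#S` (counted from `0`), hence `m - 1 - #S` points. A swapped pair is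
counted when its overtaking party is placed: `z` overtakes exactly the parties with old place below
`z` that are not in `S` yet. The same observation reduces `KeepsCoalition` to a condition on `z` and
`S` alone. -/
theorem Arrangement.snoc {g : ℕ → ℕ} {r : ℕ} {S : Finset ℕ} {a b k : ℕ}
    (h : Arrangement m ty strict g r S a b k) {z : ℕ} (hz : z ∉ S)
    (hk : strict → ty z = 0 → ∀ z' < z, ty z' ≠ 0 → z' ∈ S) :
    Arrangement m ty strict (Function.update g r z) (r + 1) (insert z S)
      (a + if ty z = 0 then 0 else m - 1 - #S) (b + if ty z = 2 then m - #S else 0)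
      (k + #(range z \ S)) := by
  have hg : ∀ j < r, Function.update g r z j = g j := fun j hj => by
    rw [Function.update_of_ne hj.ne]
  have him : ∀ j ≤ r, (range j).image (Function.update g r z) = (range j).image g := fun j hj =>
    image_congr fun i hi => hg i (by have := mem_range.mp (mem_coe.mp hi); omega)
  refine ⟨?_, ?_, ?_, ?_, ?_, ?_⟩
  · rw [range_add_one, image_insert, him r le_rfl, h.image]; simp
  · rw [card_insert_of_notMem hz, h.card]
  · rw [← h.coalition, coalitionSum, sum_range_succ, Function.update_self, h.card]
    congr 1
    exact sum_congr rfl fun j hj => by rw [hg j (mem_range.mp hj)]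
  · rw [← h.preferred, preferredSum, sum_range_succ, Function.update_self, h.card]
    congr 1
    exact sum_congr rfl fun j hj => by rw [hg j (mem_range.mp hj)]
  · rw [← h.swap, swapSum, sum_range_succ, Function.update_self, him r le_rfl, h.image]
    congr 1
    exact sum_congr rfl fun j hj => by
      rw [hg j (mem_range.mp hj), him j (mem_range.mp hj).le]
  · intro hs j hj
    rcases Nat.lt_succ_iff_lt_or_eq.mp hj with hj | rfl
    · rw [hg j hj, him j hj.le]; exact h.keeps hs j hj
    · rw [Function.update_self, him j le_rfl, h.image]; exact hk hs

theorem placed_skipMember {x y b : ℕ} (ht : ty x ≠ 1) :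
    placed m ty (x + 1) y b = placed m ty x y b := by
  refine filter_congr fun z _ => ?_
  by_cases hz : z = x
  · subst hz; simp [ht]
  · have : z < x + 1 ↔ z < x := by omega
    rw [this]

theorem placed_skipOther {x y b : ℕ} (ht : ty y ≠ 0) :
    placed m ty x (y + 1) b = placed m ty x y b := by
  refine filter_congr fun z _ => ?_
  by_cases hz : z = y
  · subst hz; simp [ht]
  · have : z < y + 1 ↔ z < y := by omega
    rw [this]

theorem placed_putMember {x y b : ℕ} (hx : x < m) (ht : ty x = 1) :
    placed m ty (x + 1) y b = insert x (placed m ty x y b) := by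
  ext z
  simp only [placed, mem_filter, mem_insert, mem_range]
  by_cases hz : z = x
  · subst hz; simp [ht, hx]
  · have : z < x + 1 ↔ z < x := by omega
    simp only [this, hz, false_or]

theorem placed_putOther {x y b : ℕ} (hy : y < m) (ht : ty y = 0) :
    placed m ty x (y + 1) b = insert y (placed m ty x y b) := by
  ext z
  simp only [placed, mem_filter, mem_insert, mem_range]
  by_cases hz : z = y
  · subst hz; simp [ht, hy]
  · have : z < y + 1 ↔ z < y := by omega
    simp only [this, hz, false_or]

theorem placed_putPreferred (hu : ∀ z z', ty z = 2 → ty z' = 2 → z = z') {x y b c : ℕ}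
    (hc : c < m) (ht : ty c = 2) (hb : b ≠ 0) :
    placed m ty x y b = insert c (placed m ty x y 0) := by
  ext z
  simp only [placed, mem_filter, mem_insert, mem_range]
  by_cases hz : z = c
  · subst hz; simp [ht, hc, hb]
  · have : ty z ≠ 2 := fun h => hz (hu _ _ h ht)
    simp only [this, hz, false_and, false_or, or_false]

/-- Soundness of the rules: the skip rules leave the set `placed` unchanged, and each put rule adds
one new party to it, which is `Arrangement.snoc`. -/
theorem Feas.exists_arrangement (hu : ∀ z z', ty z = 2 → ty z' = 2 → z = z') {x y b a k : ℕ}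
    (h : Feas m ty strict x y b a k) :
    ∃ g, Arrangement m ty strict g #(placed m ty x y b) (placed m ty x y b) a b k := by
  induction h with
  | nil =>
    have : placed m ty 0 0 0 = ∅ := by simp [placed]
    rw [this]
    exact ⟨id, by simp, by simp, by simp [coalitionSum], by simp [preferredSum],
      by simp [swapSum], fun _ j hj => by simp at hj⟩
  | skipMember hx ht _ ih => rwa [placed_skipMember ht]
  | skipOther hx ht _ ih => rwa [placed_skipOther ht]
  | @putMember x y b a k hx ht _ ih =>
    obtain ⟨g, hg⟩ := ih
    have hn : x ∉ placed m ty x y b := by simp [placed, ht]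
    have hs := hg.snoc hn (by simp [ht])
    rw [placed_putMember hx ht, card_insert_of_notMem hn]
    exact ⟨_, by simpa [ht] using hs⟩
  | @putOther x y b a k hx ht hk _ ih =>
    obtain ⟨g, hg⟩ := ih
    have hn : y ∉ placed m ty x y b := by simp [placed, ht]
    have hs := hg.snoc hn fun hs _ => hk hs
    rw [placed_putOther hx ht, card_insert_of_notMem hn]
    exact ⟨_, by simpa [ht] using hs⟩
  | @putPreferred x y a k c hc ht _ ih =>
    obtain ⟨g, hg⟩ := ih
    have hn : c ∉ placed m ty x y 0 := by simp [placed, ht]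
    have hlt : #(placed m ty x y 0) < m := by
      have : #(placed m ty x y 0) < #(range m) :=
        card_lt_card ⟨filter_subset _ _, fun h => hn (h (mem_range.mpr hc))⟩
      simpa using this
    have hs := hg.snoc hn (by simp [ht])
    -- The new third index is nonzero because `c` itself is not yet placed. Storing the points plus
    -- one separates a preferred party in the last place, with no points, from one that is not
    -- placed.
    rw [placed_putPreferred hu hc ht (b := m - #(placed m ty x y 0)) (by omega),
      card_insert_of_notMem hn]
    exact ⟨_, by simpa [ht] using hs⟩

/-- The parties of the kinds `0` and `1` stay in the old order among themselves. -/
def KeepsKinds (m : ℕ) (ty g : ℕ → ℕ) : Prop :=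
  ∀ j < m, ty (g j) ≠ 2 → ∀ z < g j, ty z = ty (g j) → z ∈ (range j).image g

/-- Completeness of the rules, by peeling off the last rule. If place `x - 1` or `y - 1` is not of
the kind its queue collects, that rule was a skip. Otherwise the party `g r` in the last filled
place is the front of its queue or the preferred party, because each kind appears in its old order,
and a put rule applies. Each case lowers `x + y + r`. -/
theorem feas_of_prefix (hty : ∀ z, ty z ≤ 2) (hu : ∀ z z', ty z = 2 → ty z' = 2 → z = z')
    {g : ℕ → ℕ} (hinj : Set.InjOn g (range m)) (hgm : ∀ j < m, g j < m)
    (hk : strict → KeepsCoalition ty g m)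
    (hn : KeepsKinds m ty g) :
    ∀ s x y r : ℕ, x + y + r = s → x ≤ m → y ≤ m → r ≤ m →
      placed m ty x y (preferredSum m ty g r) = (range r).image g →
      Feas m ty strict x y (preferredSum m ty g r) (coalitionSum m ty g r) (swapSum g r) := by
  intro s
  induction s using Nat.strong_induction_on with
  | _ s ih =>
  intro x y r hs hxm hym hrm hX
  by_cases hx : 0 < x ∧ ty (x - 1) ≠ 1
  · obtain ⟨x, rfl⟩ : ∃ x', x = x' + 1 := ⟨x - 1, by omega⟩
    simp only [Nat.add_sub_cancel] at hx
    refine Feas.skipMember (by omega) hx.2 (ih _ (by omega) x y r rfl (by omega) hym hrm ?_)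
    rw [← hX, placed_skipMember hx.2]
  by_cases hy : 0 < y ∧ ty (y - 1) ≠ 0
  · obtain ⟨y, rfl⟩ : ∃ y', y = y' + 1 := ⟨y - 1, by omega⟩
    simp only [Nat.add_sub_cancel] at hy
    refine Feas.skipOther (by omega) hy.2 (ih _ (by omega) x y r rfl hxm (by omega) hrm ?_)
    rw [← hX, placed_skipOther hy.2]
  obtain rfl | ⟨r, rfl⟩ : r = 0 ∨ ∃ r', r = r' + 1 := by
    cases r with
    | zero => exact Or.inl rfl
    | succ r => exact Or.inr ⟨r, rfl⟩
  -- No place is filled, while a positive `x` or `y` that cannot be skipped would put `x - 1` or `y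
  -- - 1` into `placed`.
  · have hx0 : x = 0 := by
      by_contra h
      have : x - 1 ∈ placed m ty x y (preferredSum m ty g 0) := by
        simp only [placed, mem_filter, mem_range]
        exact ⟨by omega, Or.inl ⟨by by_contra h1; exact hx ⟨by omega, h1⟩, by omega⟩⟩
      rw [hX] at this; simp at this
    have hy0 : y = 0 := by
      by_contra h
      have : y - 1 ∈ placed m ty x y (preferredSum m ty g 0) := by
        simp only [placed, mem_filter, mem_range]
        exact ⟨by omega, Or.inr (Or.inl ⟨by by_contra h1; exact hy ⟨by omega, h1⟩, by omega⟩)⟩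
      rw [hX] at this; simp at this
    subst hx0 hy0
    simpa [preferredSum, coalitionSum, swapSum] using Feas.nil
  have hzX : g r ∈ placed m ty x y (preferredSum m ty g (r + 1)) := by
    rw [hX]; exact mem_image_of_mem _ (by simp)
  have hnot : g r ∉ (range r).image g := by
    simp only [mem_image, mem_range, not_exists, not_and]
    intro j hj he
    have := hinj (by simp; omega) (by simp; omega) he
    omega
  have hprev : ∀ w, w ∈ (range (r + 1)).image g → w ≠ g r → w ∈ (range r).image g := by
    intro w hw hne
    rw [range_add_one, image_insert, mem_insert] at hw
    exact hw.resolve_left hne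
  have hcard : #((range r).image g) = r := by
    rw [card_image_of_injOn, card_range]
    exact hinj.mono (by intro j; simp; omega)
  -- A later party `w` of the same kind that is already placed would, by `KeepsKinds`, have `g r`
  -- placed before it, against injectivity of `g`.
  have hlast : ∀ w, w ∈ (range (r + 1)).image g → ty w = ty (g r) → ty w ≠ 2 → w ≤ g r := by
    intro w hw ht h2
    by_contra hlt
    have hw' := hprev w hw (by omega)
    obtain ⟨j, hj, rfl⟩ := mem_image.mp hw'
    have hj := mem_range.mp hj
    obtain ⟨i, hi, he⟩ := mem_image.mp (hn j (by omega) h2 (g r) (by omega) ht.symm)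
    have hi := mem_range.mp hi
    have := hinj (by simp; omega) (by simp; omega) he
    omega
  have hXr : (range r).image g = (placed m ty x y (preferredSum m ty g (r + 1))).erase (g r) := by
    rw [hX, range_add_one, image_insert, erase_insert hnot]
  have hzm : g r < m := hgm r (by omega)
  have ht := hty (g r)
  have hA : coalitionSum m ty g (r + 1) =
      coalitionSum m ty g r + if ty (g r) = 0 then 0 else m - 1 - r := sum_range_succ _ _
  have hB : preferredSum m ty g (r + 1) =
      preferredSum m ty g r + if ty (g r) = 2 then m - r else 0 := sum_range_succ _ _
  have hK : swapSum g (r + 1) = swapSum g r + #(range (g r) \ (range r).image g) :=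
    sum_range_succ _ _
  obtain h0 | h1 | h2 : ty (g r) = 0 ∨ ty (g r) = 1 ∨ ty (g r) = 2 := by omega
  · have hB' : preferredSum m ty g (r + 1) = preferredSum m ty g r := by simp [hB, h0]
    have hlt : g r < y := by
      simp only [placed, mem_filter, h0] at hzX; omega
    have hyz : y = g r + 1 := by
      have hmem : y - 1 ∈ placed m ty x y (preferredSum m ty g (r + 1)) := by
        simp only [placed, mem_filter, mem_range]
        exact ⟨by omega, Or.inr (Or.inl ⟨by by_contra h; exact hy ⟨by omega, h⟩, by omega⟩)⟩
      have ht' : ty (y - 1) = 0 := by by_contra h; exact hy ⟨by omega, h⟩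
      have := hlast _ (hX ▸ hmem) (by rw [ht', h0]) (by omega)
      omega
    subst hyz
    have hX' : placed m ty x (g r) (preferredSum m ty g r) = (range r).image g := by
      rw [hXr, hB', placed_putOther hzm h0, erase_insert (by simp [placed, h0])]
    rw [hB', hA, hK, if_pos h0, add_zero, ← hX']
    refine Feas.putOther hzm h0 ?_ (ih _ (by omega) x (g r) r rfl hxm (by omega) (by omega) hX')
    intro hst z hz hz0
    rw [hX']
    exact hk hst r (by omega) h0 z hz hz0
  · have hB' : preferredSum m ty g (r + 1) = preferredSum m ty g r := by simp [hB, h1]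
    have hlt : g r < x := by
      simp only [placed, mem_filter, h1] at hzX; omega
    have hxz : x = g r + 1 := by
      have ht' : ty (x - 1) = 1 := by by_contra h; exact hx ⟨by omega, h⟩
      have hmem : x - 1 ∈ placed m ty x y (preferredSum m ty g (r + 1)) := by
        simp only [placed, mem_filter, mem_range]
        exact ⟨by omega, Or.inl ⟨ht', by omega⟩⟩
      have := hlast _ (hX ▸ hmem) (by rw [ht', h1]) (by omega)
      omega
    subst hxz
    have hX' : placed m ty (g r) y (preferredSum m ty g r) = (range r).image g := by
      rw [hXr, hB', placed_putMember hzm h1, erase_insert (by simp [placed, h1])]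
    rw [hB', hA, hK, if_neg (by omega)]
    have := Feas.putMember hzm h1
      (ih _ (by omega) (g r) y r rfl (by omega) hym (by omega) hX')
    rwa [hX', hcard] at this
  -- Only one party is preferred and it sits in place `r`, so no earlier place contributes.
  · have hB0 : preferredSum m ty g r = 0 := by
      refine sum_eq_zero fun j hj => ?_
      have hj := mem_range.mp hj
      rw [if_neg]
      intro h
      have := hinj (by simp; omega) (by simp; omega) (hu _ _ h h2)
      omega
    have hX' : placed m ty x y (preferredSum m ty g r) = (range r).image g := by
      have hne : preferredSum m ty g (r + 1) ≠ 0 := by rw [hB, if_pos h2]; omega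
      rw [hXr, hB0, placed_putPreferred hu hzm h2 hne, erase_insert (by simp [placed, h2])]
    have hf := ih _ (by omega) x y r rfl hxm hym (by omega) hX'
    rw [hB0] at hf hX'
    have := Feas.putPreferred (g r) hzm h2 hf
    rw [hX', hcard] at this
    have h0 : ty (g r) ≠ 0 := by omega
    rwa [hB, hB0, hA, hK, if_neg h0, if_pos h2, zero_add]

theorem placed_top (hty : ∀ z, ty z ≤ 2) {b : ℕ} (hb : b ≠ 0) : placed m ty m m b = range m := by
  refine filter_true_of_mem fun z hz => ?_
  have := hty z
  have := mem_range.mp hz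
  omega

end Voter

end CoalitionBribery

/-! ### The exchange argument, and the translation between orders and arrangements. -/

namespace CoalitionBribery

open Finset

section Orders

variable {m : ℕ}

/-- Kind of the party in place `z` of `O`: preferred `2`, else in the coalition `1`, else `0`. -/
def kind (A : Finset (Fin m)) (c₁ : Fin m) (O : Pref m) (z : ℕ) : ℕ :=
  if h : z < m then
    if O.symm ⟨z, h⟩ = c₁ then 2 else if O.symm ⟨z, h⟩ ∈ A then 1 else 0
  else 0

/-- Points of the parties of `A` in the order `O`, as a natural number. -/
def score (A : Finset (Fin m)) (O : Pref m) : ℕ := ∑ c ∈ A, (m - 1 - O c)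

/-- From `O` to `O'` no party of `A` falls below a party outside `A` that it was above. -/
def Keeps (A : Finset (Fin m)) (O O' : Pref m) : Prop :=
  ∀ x ∈ A, ∀ y ∉ A, ¬ (pos O x < pos O y ∧ pos O' y < pos O' x)

theorem mem_swapped {O O' : Pref m} {q : Fin m × Fin m} :
    q ∈ swapped O O' ↔ O q.1 < O q.2 ∧ O' q.2 < O' q.1 := by
  simp [swapped, pos]

theorem keeps_iff {A : Finset (Fin m)} {O O' : Pref m} :
    Keeps A O O' ↔ ∀ x ∈ A, ∀ y ∉ A, O x < O y → O' x < O' y := by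
  simp only [Keeps, pos, not_and, not_lt, add_lt_add_iff_right, Fin.val_fin_lt]
  refine forall₂_congr fun x hx => forall₂_congr fun y hy => imp_congr_right fun _ => ?_
  have : O' x ≠ O' y := fun h => hy (O'.injective h ▸ hx)
  exact ⟨fun h => lt_of_le_of_ne h this, le_of_lt⟩

variable {A : Finset (Fin m)} {c₁ : Fin m} {O O' : Pref m}

theorem kind_le (z : ℕ) : kind A c₁ O z ≤ 2 := by
  unfold kind; split_ifs <;> omega

theorem kind_apply (c : Fin m) :
    kind A c₁ O (O c) = if c = c₁ then 2 else if c ∈ A then 1 else 0 := by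
  simp [kind]

theorem kind_eq_two {z : ℕ} : kind A c₁ O z = 2 ↔ z = O c₁ := by
  constructor
  · intro h
    unfold kind at h
    split_ifs at h with h1 h2
    · rw [← h2]; simp
    · omega
  · rintro rfl; simp [kind_apply]

theorem kind_eq_zero (hc : c₁ ∈ A) {c : Fin m} : kind A c₁ O (O c) = 0 ↔ c ∉ A := by
  rw [kind_apply]
  split_ifs with h1 h2
  · subst h1; simpa using hc
  · simpa using h2
  · simpa using h2

/-- Undoing the inversion of a pair of parties makes fewer swapped pairs. -/
theorem card_swapped_swap_lt {x₁ x₂ : Fin m} (h : O x₁ < O x₂) (h' : O' x₂ < O' x₁) :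
    #(swapped O ((Equiv.swap x₁ x₂).trans O')) < #(swapped O O') := by
  set w := Equiv.swap x₁ x₂ with hw
  have hne : x₁ ≠ x₂ := by rintro rfl; exact lt_irrefl _ h
  have hww : ∀ z, w (w z) = z := fun z => Equiv.swap_apply_self _ _ _
  -- A pair that becomes swapped only through the exchange involves `x₁` or `x₂`; applying `w` to
  -- both entries yields a pair that was swapped before.
  have key : ∀ q ∈ swapped O (w.trans O'), q ∉ swapped O O' → (w q.1, w q.2) ∈ swapped O O' := by
    rintro ⟨u, v⟩ hq hn
    simp only [mem_swapped, Equiv.trans_apply] at hq hn ⊢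
    refine ⟨?_, hq.2⟩
    have hn := not_lt.mp fun h => hn ⟨hq.1, h⟩
    by_cases u1 : u = x₁
    · subst u1
      have e1 : w u = x₂ := Equiv.swap_apply_left _ _
      by_cases v2 : v = x₂
      · subst v2
        have e2 : w v = u := Equiv.swap_apply_right _ _
        rw [e1, e2] at hq
        exact absurd hq.2 (not_lt.mpr h'.le)
      · have v1 : v ≠ u := by rintro rfl; exact lt_irrefl _ hq.1
        have e2 : w v = v := Equiv.swap_apply_of_ne_of_ne v1 v2
        rw [e1, e2] at hq
        exact absurd (hq.2.trans h') (not_lt.mpr hn)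
    by_cases u2 : u = x₂
    · subst u2
      have e1 : w u = x₁ := Equiv.swap_apply_right _ _
      by_cases v1 : v = x₁
      · subst v1; exact absurd (hq.1.trans h) (lt_irrefl _)
      · have v2 : v ≠ u := by rintro rfl; exact lt_irrefl _ hq.1
        rw [e1, show w v = v from Equiv.swap_apply_of_ne_of_ne v1 v2]
        exact h.trans hq.1
    have e1 : w u = u := Equiv.swap_apply_of_ne_of_ne u1 u2
    by_cases v1 : v = x₁
    · subst v1
      rw [e1, show w v = x₂ from Equiv.swap_apply_left _ _]
      exact hq.1.trans h
    by_cases v2 : v = x₂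
    · subst v2
      have e2 : w v = x₁ := Equiv.swap_apply_right _ _
      rw [e1, e2] at hq
      exact absurd (h'.trans hq.2) (not_lt.mpr hn)
    rw [e1, show w v = v from Equiv.swap_apply_of_ne_of_ne v1 v2]
    exact hq.1
  have hlast : (x₁, x₂) ∈ swapped O O' := mem_swapped.mpr ⟨h, h'⟩
  have hnot : (x₁, x₂) ∉ swapped O (w.trans O') := by
    rw [mem_swapped]
    simp only [Equiv.trans_apply, hw, Equiv.swap_apply_left, Equiv.swap_apply_right, not_and,
      not_lt]
    exact fun _ => h'.le
  -- The injection fixes the pairs swapped under both orders and applies `w` to the others. Its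
  -- image misses `(x₁, x₂)`, which gives strictness.
  refine lt_of_le_of_lt (card_le_card_of_injOn (t := (swapped O O').erase (x₁, x₂))
    (fun q => if q ∈ swapped O O' then q else (w q.1, w q.2)) ?_ ?_) (card_erase_lt_of_mem hlast)
  · intro q hq
    have hq := mem_coe.mp hq
    simp only [coe_erase, Set.mem_sdiff, mem_coe, Set.mem_singleton_iff]
    split_ifs with hs
    · exact ⟨hs, fun he => hnot (he ▸ hq)⟩
    · refine ⟨key q hq hs, fun he => ?_⟩
      have e1 : q.1 = x₂ := by
        have := congrArg (fun p => w p.1) he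
        simpa [hww, hw] using this
      have e2 : q.2 = x₁ := by
        have := congrArg (fun p => w p.2) he
        simpa [hww, hw] using this
      have := (mem_swapped.mp hq).1
      rw [e1, e2] at this
      exact lt_asymm this h
  · have aux : ∀ q ∈ swapped O (w.trans O'), ∀ q' ∈ swapped O (w.trans O'), q ∈ swapped O O' →
        q' ∉ swapped O O' → q ≠ (w q'.1, w q'.2) := by
      rintro q hq q' hq' - hs' rfl
      have h1 := (mem_swapped.mp hq).2
      simp only [Equiv.trans_apply, hww] at h1
      exact hs' (mem_swapped.mpr ⟨(mem_swapped.mp hq').1, h1⟩)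
    intro q hq q' hq' he
    have hq := mem_coe.mp hq
    have hq' := mem_coe.mp hq'
    simp only at he
    split_ifs at he with hs hs' hs'
    · exact he
    · exact absurd he (aux q hq q' hq' hs hs')
    · exact absurd he.symm (aux q' hq' q hq hs' hs)
    · have e := Prod.ext_iff.mp he
      exact Prod.ext (w.injective e.1) (w.injective e.2)

/-- Within the coalition without the preferred party, and within the rest, the order is kept. -/
def Sorted (A : Finset (Fin m)) (c₁ : Fin m) (O O' : Pref m) : Prop :=
  ∀ x₁ x₂, x₁ ≠ c₁ → x₂ ≠ c₁ → (x₁ ∈ A ↔ x₂ ∈ A) → O x₁ < O x₂ → O' x₁ < O' x₂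

/-- As long as two parties of the same non-preferred kind are inverted, exchange them. The coalition
occupies the same set of places and `c₁` does not move, while `card_swapped_swap_lt` makes the
process terminate. -/
theorem exists_sorted (A : Finset (Fin m)) (c₁ : Fin m) (O O' : Pref m) :
    ∃ O'' : Pref m, Sorted A c₁ O O'' ∧ score A O'' = score A O' ∧ O'' c₁ = O' c₁ ∧
      #(swapped O O'') ≤ #(swapped O O') ∧ (Keeps A O O' → Keeps A O O'') := by
  induction hk : #(swapped O O') using Nat.strong_induction_on generalizing O' with
  | _ k ih =>
  by_cases hs : Sorted A c₁ O O'
  · exact ⟨O', hs, rfl, rfl, hk.le, id⟩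
  simp only [Sorted, not_forall] at hs
  obtain ⟨x₁, x₂, h1, h2, hA, h, h'⟩ := hs
  have hne : x₁ ≠ x₂ := by rintro rfl; exact lt_irrefl _ h
  have h' : O' x₂ < O' x₁ := lt_of_le_of_ne (not_lt.mp h') fun e => hne (O'.injective e).symm
  have hlt := card_swapped_swap_lt h h'
  obtain ⟨O'', hs, hsc, hc, hcard, hkeep⟩ := ih _ (hk ▸ hlt) ((Equiv.swap x₁ x₂).trans O') rfl
  have hmem : ∀ z, Equiv.swap x₁ x₂ z ∈ A ↔ z ∈ A := by
    intro z
    by_cases z1 : z = x₁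
    · subst z1; rw [Equiv.swap_apply_left]; exact hA.symm
    by_cases z2 : z = x₂
    · subst z2; rw [Equiv.swap_apply_right]; exact hA
    rw [Equiv.swap_apply_of_ne_of_ne z1 z2]
  refine ⟨O'', hs, hsc.trans ?_, hc.trans ?_, hcard.trans (hk ▸ hlt.le), fun hK => hkeep ?_⟩
  · refine sum_equiv (Equiv.swap x₁ x₂) (fun z => (hmem z).symm) fun z _ => rfl
  · rw [Equiv.trans_apply, Equiv.swap_apply_of_ne_of_ne h1.symm h2.symm]
  -- Both exchanged parties lie on the same side of the coalition. The one moving up in `O'` needs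
  -- care only if it is outside, the one moving down only if it is inside; in either case the old
  -- order between `x₁` and `x₂` provides the comparison through the other party.
  · rw [keeps_iff] at hK ⊢
    intro x hx y hy hxy
    simp only [Equiv.trans_apply]
    by_cases hx1 : x₁ ∈ A
    · have hx2 := hA.mp hx1
      have y1 : y ≠ x₁ := by rintro rfl; exact hy hx1
      have y2 : y ≠ x₂ := by rintro rfl; exact hy hx2
      rw [Equiv.swap_apply_of_ne_of_ne y1 y2]
      by_cases e1 : x = x₁
      · subst e1; rw [Equiv.swap_apply_left]; exact h'.trans (hK _ hx _ hy hxy)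
      by_cases e2 : x = x₂
      · subst e2; rw [Equiv.swap_apply_right]; exact hK _ hx1 _ hy (h.trans hxy)
      rw [Equiv.swap_apply_of_ne_of_ne e1 e2]; exact hK _ hx _ hy hxy
    · have hx2 := fun h => hx1 (hA.mpr h)
      have e1 : x ≠ x₁ := by rintro rfl; exact hx1 hx
      have e2 : x ≠ x₂ := by rintro rfl; exact hx2 hx
      rw [Equiv.swap_apply_of_ne_of_ne e1 e2]
      by_cases y1 : y = x₁
      · subst y1; rw [Equiv.swap_apply_left]; exact hK _ hx _ hx2 (hxy.trans h)
      by_cases y2 : y = x₂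
      · subst y2; rw [Equiv.swap_apply_right]; exact (hK _ hx _ hy hxy).trans h'
      rw [Equiv.swap_apply_of_ne_of_ne y1 y2]; exact hK _ hx _ hy hxy

variable {g : ℕ → ℕ}

theorem coalitionSum_eq (hc : c₁ ∈ A) (hg : ∀ j : Fin m, g j = O (O'.symm j)) :
    coalitionSum m (kind A c₁ O) g m = score A O' := by
  rw [coalitionSum, sum_range, score, ← Equiv.sum_comp O', ← univ_inter A, ← sum_ite_mem]
  refine sum_congr rfl fun c _ => ?_
  rw [hg, O'.symm_apply_apply, univ_inter]
  by_cases h : c ∈ A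
  · rw [if_neg (by simpa [kind_eq_zero hc] using h), if_pos h]
  · rw [if_pos (by simpa [kind_eq_zero hc] using h), if_neg h]

theorem preferredSum_eq (hg : ∀ j : Fin m, g j = O (O'.symm j)) :
    preferredSum m (kind A c₁ O) g m = m - 1 - O' c₁ + 1 := by
  rw [preferredSum, sum_range, sum_eq_single (O' c₁)]
  · rw [hg, O'.symm_apply_apply, kind_apply, if_pos rfl, if_pos rfl]
    have := (O' c₁).isLt
    omega
  · intro j _ hj
    rw [hg, if_neg]
    rw [kind_eq_two]
    intro h
    have := O.injective (Fin.ext h)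
    exact hj (by rw [← this]; simp)
  · simp

theorem mem_image_range_iff (hg : ∀ j : Fin m, g j = O (O'.symm j)) {r : ℕ} (hr : r ≤ m)
    (c : Fin m) : (O c : ℕ) ∈ (range r).image g ↔ (O' c : ℕ) < r := by
  simp only [mem_image, mem_range]
  constructor
  · rintro ⟨j, hj, he⟩
    have h1 := hg ⟨j, by omega⟩
    simp only at h1
    rw [h1] at he
    have := O.injective (Fin.ext he)
    rw [← this]; simpa using hj
  · intro h
    exact ⟨O' c, h, by rw [hg]; simp⟩

/-- The swapped pairs are fibred over the new place `j` of the overtaking party `q.2`. Within a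
fibre a pair is determined by the old place of the overtaken party, which is below `g j` and not
among the first `j` entries of `g`. -/
theorem swapSum_eq (hg : ∀ j : Fin m, g j = O (O'.symm j)) : swapSum g m = #(swapped O O') := by
  rw [swapSum, sum_range, card_eq_sum_card_fiberwise (f := fun q => O' q.2) (t := univ) (by simp)]
  refine sum_congr rfl fun j _ => ?_
  symm
  refine card_bij (fun q _ => (O q.1 : ℕ)) ?_ ?_ ?_
  · rintro ⟨x, y⟩ hq
    simp only [mem_filter, mem_swapped] at hq
    obtain ⟨⟨h1, h2⟩, rfl⟩ := hq
    simp only [mem_sdiff, mem_range, hg, Equiv.symm_apply_apply]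
    rw [mem_image_range_iff hg (by omega)]
    simp only [Fin.val_fin_lt, not_lt]
    exact ⟨h1, h2.le⟩
  · rintro ⟨x, y⟩ hq ⟨x', y'⟩ hq' he
    simp only [mem_filter] at hq hq'
    have e1 := O.injective (Fin.ext he)
    have e2 := O'.injective (hq.2.trans hq'.2.symm)
    exact Prod.ext e1 e2
  · intro z hz
    simp only [mem_sdiff, mem_range, hg] at hz
    have hzm : z < m := by omega
    refine ⟨(O.symm ⟨z, hzm⟩, O'.symm j), ?_, by simp⟩
    have h2 := mt (mem_image_range_iff (r := (j : ℕ)) hg (by omega) (O.symm ⟨z, hzm⟩)).mpr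
      (by simpa using hz.2)
    simp only [mem_filter, mem_swapped, Equiv.apply_symm_apply, and_true]
    refine ⟨by simpa [Fin.lt_def] using hz.1, lt_of_le_of_ne (by simpa using h2) fun e => ?_⟩
    have : O'.symm j = O.symm ⟨z, hzm⟩ := by rw [e]; simp
    rw [this] at hz
    simp at hz

theorem keepsCoalition_iff (hc : c₁ ∈ A) (hg : ∀ j : Fin m, g j = O (O'.symm j)) :
    KeepsCoalition (kind A c₁ O) g m ↔ Keeps A O O' := by
  rw [keeps_iff]
  constructor
  · intro h x hx y hy hxy
    have := h (O' y) (by omega) (by rw [hg]; simpa [kind_eq_zero hc] using hy) (O x)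
      (by rw [hg]; simpa using hxy) (by simpa [kind_eq_zero hc] using hx)
    rw [mem_image_range_iff hg (by omega)] at this
    exact this
  · intro h j hj h0 z hz hz0
    obtain ⟨y, rfl⟩ : ∃ y, (O' y : ℕ) = j := ⟨O'.symm ⟨j, hj⟩, by simp⟩
    rw [hg, Equiv.symm_apply_apply] at h0 hz
    obtain ⟨x, rfl⟩ : ∃ x, (O x : ℕ) = z := ⟨O.symm ⟨z, by omega⟩, by simp⟩
    rw [mem_image_range_iff hg (by omega)]
    rw [kind_eq_zero hc] at h0
    exact h x (by simpa [kind_eq_zero hc] using hz0) y h0 hz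

variable {strict : Prop}

/-- This is `feas_of_prefix` for the full arrangement, with both queues read to the end, where `g j`
is the old place of the party that `O'` puts in place `j`. -/
theorem feas_of_sorted (hc : c₁ ∈ A) (hs : Sorted A c₁ O O') (hk : strict → Keeps A O O') :
    Feas m (kind A c₁ O) strict m m (m - 1 - O' c₁ + 1) (score A O') #(swapped O O') := by
  set g : ℕ → ℕ := fun j => if h : j < m then O (O'.symm ⟨j, h⟩) else 0 with hgdef
  have hg : ∀ j : Fin m, g j = O (O'.symm j) := fun j => by simp [hgdef]
  have hinj : Set.InjOn g (range m) := by
    intro i hi j hj he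
    simp only [coe_range, Set.mem_Iio] at hi hj
    have h1 := hg ⟨i, hi⟩
    have h2 := hg ⟨j, hj⟩
    simp only at h1 h2
    rw [h1, h2] at he
    simpa using O'.symm.injective (O.injective (Fin.ext he))
  have hgm : ∀ j < m, g j < m := fun j hj => by
    have h1 := hg ⟨j, hj⟩
    simp only at h1
    rw [h1]; exact Fin.isLt _
  have him : (range m).image g = range m := by
    refine eq_of_subset_of_card_le ?_ ?_
    · intro z hz
      obtain ⟨j, hj, rfl⟩ := mem_image.mp hz
      exact mem_range.mpr (hgm j (mem_range.mp hj))
    · rw [card_image_of_injOn hinj]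
  have := feas_of_prefix (m := m) (ty := kind A c₁ O) (strict := strict) kind_le
    (fun z z' h h' => by rw [kind_eq_two] at h h'; rw [h, h']) hinj hgm
    (fun h => (keepsCoalition_iff hc hg).mpr (hk h)) ?_ _ m m m rfl le_rfl le_rfl le_rfl ?_
  · rwa [preferredSum_eq hg, coalitionSum_eq hc hg, swapSum_eq hg] at this
  · intro j hj h2 z hz he
    obtain ⟨y, rfl⟩ : ∃ y, (O' y : ℕ) = j := ⟨O'.symm ⟨j, hj⟩, by simp⟩
    rw [hg, Equiv.symm_apply_apply] at h2 hz he
    obtain ⟨x, rfl⟩ : ∃ x, (O x : ℕ) = z := ⟨O.symm ⟨z, by omega⟩, by simp⟩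
    rw [mem_image_range_iff hg (by omega)]
    have hy : y ≠ c₁ := by rintro rfl; simp [kind_apply] at h2
    have hx : x ≠ c₁ := by rintro rfl; rw [← he] at h2; simp [kind_apply] at h2
    refine hs x y hx hy ?_ hz
    have e0 : kind A c₁ O (O x) = 0 ↔ kind A c₁ O (O y) = 0 := by rw [he]
    rw [kind_eq_zero hc, kind_eq_zero hc] at e0
    tauto
  · rw [preferredSum_eq hg, placed_top kind_le (by omega), him]

/-- With a nonzero third index and both queues exhausted, all `m` places are filled. The arrangement
is then a bijection of the places, and the new order is its inverse read in terms of parties. -/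
theorem exists_order_of_feas (hc : c₁ ∈ A) {b a k : ℕ}
    (h : Feas m (kind A c₁ O) strict m m (b + 1) a k) :
    ∃ O' : Pref m, m - 1 - O' c₁ = b ∧ score A O' = a ∧ #(swapped O O') = k ∧
      (strict → Keeps A O O') := by
  obtain ⟨g, hg⟩ := h.exists_arrangement
    (fun z z' h h' => by rw [kind_eq_two] at h h'; rw [h, h'])
  rw [placed_top kind_le (by omega), card_range] at hg
  have hgm : ∀ j : Fin m, g j < m := fun j => by
    have : g j ∈ range m := hg.image ▸ mem_image_of_mem g (mem_range.mpr j.isLt)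
    exact mem_range.mp this
  have hinj : Set.InjOn g (range m) := by
    rw [← card_image_iff, hg.image]
  have hf : Function.Injective fun j : Fin m => O.symm ⟨g j, hgm j⟩ := by
    intro i j he
    have := O.symm.injective he
    exact Fin.ext (hinj (by simp) (by simp) (Fin.mk.inj this))
  let e : Fin m ≃ Fin m := Equiv.ofBijective _ (Finite.injective_iff_bijective.mp hf)
  have hge : ∀ j : Fin m, g j = O (e.symm.symm j) := fun j => by simp [e]
  refine ⟨e.symm, ?_, ?_, ?_, fun hs => (keepsCoalition_iff hc hge).mp (hg.keeps hs)⟩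
  · have := preferredSum_eq (A := A) (c₁ := c₁) hge
    rw [hg.preferred] at this
    omega
  · rw [← coalitionSum_eq hc hge, hg.coalition]
  · rw [← swapSum_eq hge, hg.swap]

end Orders

end CoalitionBribery

/-! ## Seats without threshold, and the budget that is left for given numbers of points -/

namespace CoalitionBribery

open Finset

section SeatsWithoutThreshold

variable {m n : ℕ}

theorem borda_eq (O : Pref m) (c : Fin m) : borda O c = ((m - 1 - O c : ℕ) : ℚ) := by
  have h := (O c).isLt
  rw [borda, pos, Nat.sub_sub, Nat.cast_sub (by omega)]
  push_cast; ring

theorem points_borda (O : Fin n → Pref m) (S : Finset (Fin m)) :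
    points borda O S = ((∑ i, score S (O i) : ℕ) : ℚ) := by
  simp [points, score, borda_eq]

theorem score_univ (O : Pref m) : score univ O = m.choose 2 := by
  rw [score, Equiv.sum_comp O (fun r : Fin m => m - 1 - (r : ℕ)),
    ← sum_range (fun r => m - 1 - r), sum_range_reflect (fun r => r) m, sum_range_id,
    Nat.choose_two_right]

/-- At threshold `0` all parties are active since points are nonnegative, and the total is constant
because every order distributes `m.choose 2` points. Hence all shares have the same denominator. -/
theorem seats_borda (O : Fin n → Pref m) (S : Finset (Fin m)) :
    seats borda 0 O S = ((∑ i, score S (O i) : ℕ) : ℚ) / ((n * m.choose 2 : ℕ) : ℚ) := by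
  have hact : ∀ c, Active borda 0 O c := by
    intro c
    rw [Active, zero_mul, not_lt, points_borda]
    exact Nat.cast_nonneg _
  have huniv : points borda O univ = ((n * m.choose 2 : ℕ) : ℚ) := by
    rw [points_borda]; simp [score_univ]
  have hp : ∀ c, partySeats borda 0 O c = points borda O {c} / ((n * m.choose 2 : ℕ) : ℚ) := by
    intro c
    rw [partySeats, if_pos (hact c), ← huniv]
    simp [hact]
  rw [seats, sum_congr rfl fun c _ => hp c, ← sum_div, ← points_borda]
  congr 1
  simp only [points, sum_singleton]
  exact sum_comm

theorem mul_le_iff_num_den {q : ℚ} (hq : 0 ≤ q) (x y : ℕ) :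
    q * x ≤ y ↔ q.num.toNat * x ≤ q.den * y := by
  have hd : (0 : ℚ) < q.den := by exact_mod_cast q.pos
  have hn : ((q.num.toNat : ℕ) : ℚ) = q.num := by
    have : ((q.num.toNat : ℕ) : ℤ) = q.num := Int.toNat_of_nonneg (Rat.num_nonneg.mpr hq)
    exact_mod_cast this
  have hq' : q * q.den = q.num := Rat.mul_den_eq_num q
  rw [← Nat.cast_le (α := ℚ)]
  push_cast
  rw [hn, ← hq', mul_comm q (q.den : ℚ), mul_assoc, mul_le_mul_iff_right₀ hd]

end SeatsWithoutThreshold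

/-- The question of CBP for Borda without threshold in terms of natural numbers, where `s i k` is
the price of `k` swapped pairs at voter `i`. -/
def SwapCBP (I : Base) (strict : Prop) (s : ℕ → ℕ → ℕ) : Prop :=
  ∃ O' : Fin I.n → Pref I.m, (strict → ∀ i, Keeps I.A (I.orders i) (O' i)) ∧
    ∑ i : Fin I.n, s i #(swapped (I.orders i) (O' i)) ≤ I.budget ∧
    I.φ.num.toNat * (I.n * I.m.choose 2) ≤ I.φ.den * ∑ i, score I.A (O' i) ∧
    I.ρ.num.toNat * ∑ i, score I.A (O' i) ≤ I.ρ.den * ∑ i, (I.m - 1 - O' i I.c₁)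

/-- The common denominator of all shares is positive and cancels; the denominators of `φ` and `ρ`
are cleared as well. The proposition `strict` switches the permissibility condition of
coalition-shift-bribery on or off, so that one statement covers the three types. -/
theorem cbp_iff_swapCBP (I : Base) (strict : Prop) (s : ℕ → ℕ → ℕ)
    (ok : Fin I.n → Pref I.m → Pref I.m → Prop) (π : Fin I.n → Pref I.m → Pref I.m → ℕ)
    (hok : ∀ i O', ok i (I.orders i) O' ↔ (strict → Keeps I.A (I.orders i) O'))
    (hπ : ∀ i O', π i (I.orders i) O' = s i #(swapped (I.orders i) O')) :
    CBP I borda 0 ok π ↔ SwapCBP I strict s := by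
  have hT : (0 : ℚ) < ((I.n * I.m.choose 2 : ℕ) : ℚ) := by
    have h1 := I.one_le_n
    have h2 := Nat.choose_pos I.two_le_m
    exact_mod_cast Nat.mul_pos h1 h2
  refine exists_congr fun O' => and_congr ?_ (and_congr ?_ (and_congr ?_ ?_))
  · simp only [hok]; exact ⟨fun h hs i => h i hs, fun h i hs => h hs i⟩
  · simp only [hπ]
  · have hu : seats borda 0 O' univ = 1 := by
      rw [seats_borda]
      simp only [score_univ, sum_const, card_univ, Fintype.card_fin, smul_eq_mul]
      exact div_self hT.ne'
    rw [hu, mul_one, seats_borda, ge_iff_le, le_div_iff₀ hT, mul_le_iff_num_den I.φ_nonneg]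
  · rw [seats_borda, seats_borda, ge_iff_le, ← mul_div_assoc, div_le_div_iff_of_pos_right hT,
      mul_le_iff_num_den I.ρ_nonneg]
    simp [score]

/-! ### The dynamic program over the voters. -/

section Budget

variable (m K N B : ℕ) (ty : ℕ → ℕ → ℕ) (strict : Prop) (s : ℕ → ℕ → ℕ)

open Classical in
/-- One more than the largest rest of the budget `B` when the first `i` voters give `a` points to
the coalition and `b` to the preferred party, or `0` if this is too expensive. -/
noncomputable def rest : ℕ → ℕ → ℕ → ℕ
  | 0, a, b => if a = 0 ∧ b = 0 then B + 1 else 0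
  | i + 1, a, b => (range N).sup fun a' => (range N).sup fun b' => (range N).sup fun k =>
      if a' ≤ a ∧ b' ≤ b ∧ b' < m ∧ k ≤ K ∧ Feas m (ty i) strict m m (b' + 1) a' k then
        rest i (a - a') (b - b') - s i k
      else 0

variable {m K N B ty strict s}

open Classical in
-- A maximum over a nonempty range is attained, so the optimal choices can be traced back voter by
-- voter. A positive value means that no subtraction was truncated, which is why the last equation
-- is exact.
theorem exists_of_rest_pos {i a b : ℕ} (h : 0 < rest m K N B ty strict s i a b) :
    ∃ al bl kl : ℕ → ℕ, (∀ j < i, Feas m (ty j) strict m m (bl j + 1) (al j) (kl j)) ∧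
      ∑ j ∈ range i, al j = a ∧ ∑ j ∈ range i, bl j = b ∧
      rest m K N B ty strict s i a b + ∑ j ∈ range i, s j (kl j) = B + 1 := by
  induction i generalizing a b with
  | zero =>
    simp only [rest] at h ⊢
    split_ifs at h ⊢ with hab
    · exact ⟨id, id, id, by simp, by simp [hab], by simp [hab], by simp⟩
    · simp at h
  | succ i ih =>
    have hN : (range N).Nonempty := by
      rw [nonempty_range_iff]
      rintro rfl
      simp [rest] at h
    obtain ⟨a', -, ha'⟩ := exists_mem_eq_sup _ hN fun a' => (range N).sup fun b' =>
      (range N).sup fun k =>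
        if a' ≤ a ∧ b' ≤ b ∧ b' < m ∧ k ≤ K ∧ Feas m (ty i) strict m m (b' + 1) a' k then
          rest m K N B ty strict s i (a - a') (b - b') - s i k
        else 0
    obtain ⟨b', -, hb'⟩ := exists_mem_eq_sup _ hN fun b' => (range N).sup fun k =>
        if a' ≤ a ∧ b' ≤ b ∧ b' < m ∧ k ≤ K ∧ Feas m (ty i) strict m m (b' + 1) a' k then
          rest m K N B ty strict s i (a - a') (b - b') - s i k
        else 0
    obtain ⟨k, -, hk⟩ := exists_mem_eq_sup _ hN fun k =>
        if a' ≤ a ∧ b' ≤ b ∧ b' < m ∧ k ≤ K ∧ Feas m (ty i) strict m m (b' + 1) a' k then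
          rest m K N B ty strict s i (a - a') (b - b') - s i k
        else 0
    have heq := ha'.trans (hb'.trans hk)
    rw [rest] at h ⊢
    rw [heq] at h ⊢
    split_ifs at h ⊢ with hc
    · obtain ⟨al, bl, kl, hf, ha, hb, hr⟩ := ih (a := a - a') (b := b - b') (by omega)
      -- Fixing the choice of voter `i` does not disturb sums over the voters before.
      have hcongr : ∀ (f : ℕ → ℕ) (v : ℕ) (F : ℕ → ℕ → ℕ), ∑ j ∈ range i,
          F j (Function.update f i v j) = ∑ j ∈ range i, F j (f j) := fun f v F =>
        sum_congr rfl fun j hj => by rw [Function.update_of_ne (mem_range.mp hj).ne]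
      refine ⟨Function.update al i a', Function.update bl i b', Function.update kl i k,
        ?_, ?_, ?_, ?_⟩
      · intro j hj
        rcases Nat.lt_succ_iff_lt_or_eq.mp hj with hj | rfl
        · simpa [hj.ne] using hf j hj
        · simpa using hc.2.2.2.2
      · rw [sum_range_succ, hcongr al a' fun _ x => x, ha, Function.update_self]; omega
      · rw [sum_range_succ, hcongr bl b' fun _ x => x, hb, Function.update_self]; omega
      · rw [sum_range_succ, hcongr kl k s, Function.update_self]
        omega
    · omega

theorem le_rest {i : ℕ} {al bl kl : ℕ → ℕ}
    (h : ∀ j < i, al j < N ∧ bl j < N ∧ kl j < N ∧ bl j < m ∧ kl j ≤ K ∧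
      Feas m (ty j) strict m m (bl j + 1) (al j) (kl j)) :
    B + 1 - ∑ j ∈ range i, s j (kl j) ≤
      rest m K N B ty strict s i (∑ j ∈ range i, al j) (∑ j ∈ range i, bl j) := by
  induction i with
  | zero => simp [rest]
  | succ i ih =>
    have ih := ih fun j hj => h j (by omega)
    obtain ⟨h1, h2, h3, h4, h5, h6⟩ := h i (by omega)
    simp only [sum_range_succ]
    rw [rest]
    refine le_trans ?_ (le_sup (f := fun a' => _) (mem_range.mpr h1))
    refine le_trans ?_ (le_sup (f := fun a' => _) (mem_range.mpr h2))
    refine le_trans ?_ (le_sup (f := fun a' => _) (mem_range.mpr h3))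
    simp only [Nat.add_sub_cancel]
    rw [if_pos ⟨by omega, by omega, h4, h5, h6⟩]
    omega

end Budget

/-- The kind of the party in place `z` of the order of voter `i`. -/
def voterKind (I : Base) (i z : ℕ) : ℕ :=
  if h : i < I.n then kind I.A I.c₁ (I.orders ⟨i, h⟩) z else 0

theorem score_lt {m : ℕ} (hm : 0 < m) (A : Finset (Fin m)) (O : Pref m) : score A O < m * m := by
  have : score A O ≤ ∑ _c : Fin m, (m - 1) := by
    refine (sum_le_sum_of_subset (subset_univ A)).trans (sum_le_sum fun c _ => ?_)
    omega
  have h2 : m * (m - 1) < m * m := Nat.mul_lt_mul_of_pos_left (by omega) hm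
  simp at this
  omega

/-- Forward, the given orders are replaced by sorted ones; monotone prices keep this affordable, and
`le_rest` bounds the table value from below. Backward, the traced choices are realised by orders
voter by voter. The bound `M` lies above all totals, and `N` above all values for a single voter. -/
theorem swapCBP_iff (I : Base) (strict : Prop) (s : ℕ → ℕ → ℕ)
    (hs : ∀ i < I.n, ∀ k k', k ≤ k' → k' ≤ I.m.choose 2 → s i k ≤ s i k') {M N : ℕ}
    (hM : I.n * (I.m * I.m) < M) (hMN : M ≤ N) :
    SwapCBP I strict s ↔ ∃ a < M, ∃ b < M,
      0 < rest I.m (I.m.choose 2) N I.budget (voterKind I) strict s I.n a b ∧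
      I.φ.num.toNat * (I.n * I.m.choose 2) ≤ I.φ.den * a ∧
      I.ρ.num.toNat * a ≤ I.ρ.den * b := by
  have hm := I.two_le_m
  have hn := I.one_le_n
  have hmm : I.m * I.m ≤ I.n * (I.m * I.m) := Nat.le_mul_of_pos_left _ hn
  have hmle : I.m ≤ I.m * I.m := Nat.le_mul_self _
  constructor
  · rintro ⟨O₁, hk, hB, hφ, hρ⟩
    choose O' hsort hsc hc hcard hkeep using fun i => exists_sorted I.A I.c₁ (I.orders i) (O₁ i)
    simp only [← hsc, ← hc] at hφ hρ
    set ext : (Fin I.n → ℕ) → ℕ → ℕ := fun f j => if h : j < I.n then f ⟨j, h⟩ else 0 with hext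
    have hext' : ∀ f (i : Fin I.n), ext f i = f i := fun f i => by simp [hext]
    have hle := le_rest (m := I.m) (K := I.m.choose 2) (N := N) (B := I.budget)
      (ty := voterKind I) (strict := strict) (s := s) (i := I.n)
      (al := ext fun i => score I.A (O' i)) (bl := ext fun i => I.m - 1 - O' i I.c₁)
      (kl := ext fun i => #(swapped (I.orders i) (O' i))) (by
        intro j hj
        have h1 := score_lt (by omega) I.A (O' ⟨j, hj⟩)
        have h2 := card_swapped_le (I.orders ⟨j, hj⟩) (O' ⟨j, hj⟩)
        have h3 : I.m.choose 2 ≤ I.m * I.m := by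
          rw [Nat.choose_two_right]
          exact (Nat.div_le_self _ _).trans (Nat.mul_le_mul_left _ (Nat.sub_le _ _))
        simp only [hext, dif_pos hj]
        refine ⟨by omega, by omega, by omega, by omega, h2, ?_⟩
        have : voterKind I j = kind I.A I.c₁ (I.orders ⟨j, hj⟩) := by
          ext z; simp [voterKind, hj]
        rw [this]
        exact feas_of_sorted I.c₁_mem (hsort _) fun hst => hkeep _ (hk hst _))
    simp only [sum_range, hext'] at hle
    refine ⟨_, ?_, _, ?_, lt_of_lt_of_le ?_ hle, hφ, hρ⟩
    · refine lt_of_le_of_lt ?_ hM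
      refine (sum_le_sum fun i _ => (score_lt (by omega) I.A (O' i)).le).trans ?_
      simp
    · refine lt_of_le_of_lt ?_ hM
      refine (sum_le_sum fun i _ => (?_ : I.m - 1 - (O' i I.c₁ : ℕ) ≤ I.m * I.m)).trans ?_
      · omega
      · simp
    · have : ∑ i : Fin I.n, s i #(swapped (I.orders i) (O' i)) ≤
          ∑ i : Fin I.n, s i #(swapped (I.orders i) (O₁ i)) :=
        sum_le_sum fun i _ => hs i i.isLt _ _ (hcard i) (card_swapped_le _ _)
      omega
  · rintro ⟨a, -, b, -, hpos, hφ, hρ⟩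
    obtain ⟨al, bl, kl, hf, rfl, rfl, hr⟩ := exists_of_rest_pos hpos
    have hex : ∀ i : Fin I.n, ∃ O' : Pref I.m, I.m - 1 - O' I.c₁ = bl i ∧ score I.A O' = al i ∧
        #(swapped (I.orders i) O') = kl i ∧ (strict → Keeps I.A (I.orders i) O') := by
      intro i
      have h := hf i i.isLt
      have : voterKind I i = kind I.A I.c₁ (I.orders i) := by
        ext z; simp [voterKind]
      rw [this] at h
      exact exists_order_of_feas I.c₁_mem h
    choose O' hb ha hk hkeep using hex
    refine ⟨O', fun hst i => hkeep i hst, ?_, ?_, ?_⟩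
    · simp only [hk]
      rw [sum_range fun j => s j (kl j)] at hr
      omega
    · simpa only [ha, ← sum_range] using hφ
    · simpa only [ha, hb, ← sum_range] using hρ

end CoalitionBribery

/-! ## The algorithm -/

namespace RAM

/-- The condition `e` holds: its value is nonzero. -/
def Ex.Holds (N : ℕ) (arr : ℕ → ℕ → ℕ) (e : Ex) (v : ℕ → ℕ) : Prop := e.eval N arr v ≠ 0

instance (N : ℕ) (arr : ℕ → ℕ → ℕ) (e : Ex) (v : ℕ → ℕ) : Decidable (e.Holds N arr v) :=
  inferInstanceAs (Decidable (_ ≠ 0))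

theorem Ex.eval_count (N : ℕ) (arr : ℕ → ℕ → ℕ) (x : ℕ) (c : Ex) (v : ℕ → ℕ) :
    (Ex.bsum x (.cond c (.const 1) (.const 0))).eval N arr v =
      ((Finset.range N).filter fun t => c.Holds N arr (Function.update v x t)).card := by
  rw [Finset.card_filter]
  simp only [Ex.eval, Ex.Holds]
  exact Finset.sum_congr rfl fun t _ => by split_ifs <;> simp_all

/-- The condition `e ≤ f`. -/
def Ex.le (e f : Ex) : Ex := .sub (.add f (.const 1)) e

/-- The condition `e < f`. -/
def Ex.lt (e f : Ex) : Ex := .sub f e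

/-- Conjunction of conditions. -/
def Ex.and (e f : Ex) : Ex := .cond e f (.const 0)

/-- Disjunction of conditions. -/
def Ex.or (e f : Ex) : Ex := .add e f

/-- Negation of a condition. -/
def Ex.not (e : Ex) : Ex := .cond e (.const 0) (.const 1)

/-- The condition `e = f`. -/
def Ex.eq (e f : Ex) : Ex := (e.le f).and (f.le e)

section Holds

variable {N : ℕ} {arr : ℕ → ℕ → ℕ} {e f : Ex} {v : ℕ → ℕ}

@[simp] theorem Ex.holds_le : (e.le f).Holds N arr v ↔ e.eval N arr v ≤ f.eval N arr v := by
  simp only [Holds, le, eval]; omega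

@[simp] theorem Ex.holds_lt : (e.lt f).Holds N arr v ↔ e.eval N arr v < f.eval N arr v := by
  simp only [Holds, lt, eval]; omega

@[simp] theorem Ex.holds_and : (e.and f).Holds N arr v ↔ e.Holds N arr v ∧ f.Holds N arr v := by
  simp only [Holds, and, eval]; split_ifs <;> simp_all

@[simp] theorem Ex.holds_or : (e.or f).Holds N arr v ↔ e.Holds N arr v ∨ f.Holds N arr v := by
  simp only [Holds, or, eval]; omega

@[simp] theorem Ex.holds_not : e.not.Holds N arr v ↔ ¬ e.Holds N arr v := by
  simp only [Holds, not, eval]; split_ifs <;> simp_all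

@[simp] theorem Ex.holds_eq : (e.eq f).Holds N arr v ↔ e.eval N arr v = f.eval N arr v := by
  simp only [eq, holds_and, holds_le]; omega

theorem Ex.eval_cond (c : Ex) :
    (Ex.cond c e f).eval N arr v =
      if c.Holds N arr v then e.eval N arr v else f.eval N arr v := by
  simp only [eval, Holds]; split_ifs <;> simp_all

theorem Ex.holds_bmax {x : ℕ} :
    (Ex.bmax x e).Holds N arr v ↔ ∃ t < N, e.Holds N arr (Function.update v x t) := by
  simp only [Holds, eval, ← Nat.pos_iff_ne_zero, Finset.lt_sup_iff, Finset.mem_range]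

theorem Ex.holds_bind {x : ℕ} : (Ex.bind x e f).Holds N arr v ↔
    f.Holds N arr (Function.update v x (e.eval N arr v)) := Iff.rfl

end Holds

/-- The power `N ^ t` of the bound `N`. -/
def Ex.boundPow : ℕ → Ex
  | 0 => .const 1
  | t + 1 => .mul (boundPow t) .bound

/-- The cap on the second factor has no effect, as that factor is the bound itself. -/
theorem Ex.eval_boundPow (N : ℕ) (arr : ℕ → ℕ → ℕ) (t : ℕ) (v : ℕ → ℕ) :
    (boundPow t).eval N arr v = N ^ t := by
  induction t with
  | zero => simp [boundPow, eval]
  | succ t ih => simp [boundPow, eval, ih, pow_succ]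

end RAM

/-! ### The instance in memory, and the values of the basic expressions. -/

namespace CoalitionBribery

open Finset RAM

/-- The memory holds the instance, and the base `M` of the digits is large enough. -/
structure Holding (I : Base) (M N : ℕ) (arr : ℕ → ℕ → ℕ) : Prop where
  m : arr 0 0 = I.m
  n : arr 0 1 = I.n
  budget : arr 0 2 = I.budget
  φ_num : arr 0 3 = I.φ.num.toNat
  φ_den : arr 0 4 = I.φ.den
  ρ_num : arr 0 5 = I.ρ.num.toNat
  ρ_den : arr 0 6 = I.ρ.den
  c₁ : arr 0 7 = I.c₁
  mem (c : Fin I.m) : arr 0 (8 + c) = if c ∈ I.A then 1 else 0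
  order (i : Fin I.n) (r : Fin I.m) : arr 0 (8 + I.m + i * I.m + r) = (I.orders i).symm r
  base : arr 1 0 = M
  lt_base : I.n * (I.m * I.m) < M
  -- Six digits in base `M` index the larger of the two tables.
  bound : M ^ 6 = N

section Bounds

variable {I : Base} {M N : ℕ} {arr : ℕ → ℕ → ℕ} (h : Holding I M N arr)
include h

theorem Holding.base_pos : 0 < M := lt_of_le_of_lt (Nat.zero_le _) h.lt_base

theorem Holding.base_le : M ≤ N := h.bound ▸ Nat.le_self_pow (by norm_num) M

theorem Holding.cube_le : M ^ 3 ≤ N := h.bound ▸ Nat.pow_le_pow_right h.base_pos (by norm_num)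

theorem Holding.n_lt : I.n < M := by
  refine lt_of_le_of_lt (Nat.le_mul_of_pos_right _ ?_) h.lt_base
  have := I.two_le_m
  positivity

theorem Holding.sq_lt : I.m * I.m < M :=
  lt_of_le_of_lt (Nat.le_mul_of_pos_left _ I.one_le_n) h.lt_base

theorem Holding.m_lt : I.m < M := lt_of_le_of_lt (Nat.le_mul_self _) h.sq_lt

theorem Holding.pairs_lt : I.m.choose 2 < M := by
  refine lt_of_le_of_lt ?_ h.sq_lt
  rw [Nat.choose_two_right]
  exact (Nat.div_le_self _ _).trans (Nat.mul_le_mul_left _ (Nat.sub_le _ _))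

theorem Holding.total_lt : I.n * I.m.choose 2 < M := by
  refine lt_of_le_of_lt (Nat.mul_le_mul_left _ ?_) h.lt_base
  rw [Nat.choose_two_right]
  exact (Nat.div_le_self _ _).trans (Nat.mul_le_mul_left _ (Nat.sub_le _ _))

end Bounds

namespace Code

/-- Number of parties. -/
def m : Ex := .cell 0 (.const 0)

/-- Number of voters. -/
def n : Ex := .cell 0 (.const 1)

/-- Base of the digits of the table indices. -/
def base : Ex := .cell 1 (.const 0)

/-- The party in place `z` of the order of voter `i`. -/
def party (i z : Ex) : Ex := .cell 0 (.add (.add (.add (.const 8) m) (.mul i m)) z)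

/-- The kind of the party in place `z` of the order of voter `i`. -/
def kind (i z : Ex) : Ex :=
  .cond ((party i z).eq (.cell 0 (.const 7))) (.const 2) (.cell 0 (.add (.const 8) (party i z)))

/-- Place `z` of voter `1` belongs to the set given by the variables `10`, `11`, `12`. -/
def mem (z : Ex) : Ex :=
  (z.lt m).and (((((kind (.var 1) z).eq (.const 1)).and (z.lt (.var 10))).or
    (((kind (.var 1) z).eq (.const 0)).and (z.lt (.var 11)))).or
    (((kind (.var 1) z).eq (.const 2)).and ((Ex.const 0).lt (.var 12))))

/-- Size of the set given by the variables `10`, `11`, `12`. -/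
def size : Ex := .bsum 7 (.cond (mem (.var 7)) (.const 1) (.const 0))

/-- Number of places before variable `13` outside the set given by `10`, `11`, `12`. -/
def missing : Ex :=
  .bsum 7 (.cond (((Ex.var 7).lt (.var 13)).and (mem (.var 7)).not) (.const 1) (.const 0))

/-- All coalition members before place `13` are in the set given by `10`, `11`, `12`. -/
def membersPlaced : Ex :=
  (Ex.bmax 7 ((((Ex.var 7).lt (.var 13)).and
    ((kind (.var 1) (.var 7)).eq (.const 0)).not).and (mem (.var 7)).not)).not

/-- Append a digit. -/
def digit (e f : Ex) : Ex := .add (.mul e base) f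

/-- Table of the feasible points and swaps. -/
def feas (i x y b a k : Ex) : Ex :=
  .cell 4 (digit (digit (digit (digit (digit i x) y) b) a) k)

/-- Table of the rests of the budget. -/
def rest (i a b : Ex) : Ex := .cell 5 (digit (digit i a) b)

/-- Quotient of a variable by the base. -/
def quot (x : ℕ) : Ex :=
  .bsum 7 (.cond ((Ex.mul base (.add (.var 7) (.const 1))).le (.var x)) (.const 1) (.const 0))

/-- Half of `m (m - 1)`. -/
def pairs : Ex := .bsum 7 (.cond ((Ex.var 7).lt m) (.var 7) (.const 0))

end Code

section Eval

variable {I : Base} {M N : ℕ} {arr : ℕ → ℕ → ℕ} (h : Holding I M N arr) {v : ℕ → ℕ}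
include h

theorem Holding.eval_m : Code.m.eval N arr v = I.m := h.m

theorem Holding.eval_n : Code.n.eval N arr v = I.n := h.n

theorem Holding.eval_base : Code.base.eval N arr v = M := h.base

theorem Holding.eval_digit (e f : Ex) :
    (Code.digit e f).eval N arr v = e.eval N arr v * M + f.eval N arr v := by
  simp only [Code.digit, Ex.eval, h.eval_base, min_eq_left h.base_le]

theorem Holding.eval_kind {i z : Ex} (hi : i.eval N arr v < I.n) (hz : z.eval N arr v < I.m) :
    (Code.kind i z).eval N arr v = voterKind I (i.eval N arr v) (z.eval N arr v) := by
  have hp : (Code.party i z).eval N arr v =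
      (I.orders ⟨_, hi⟩).symm ⟨_, hz⟩ := by
    simp only [Code.party, Ex.eval, h.eval_m, min_eq_left (h.m_lt.le.trans h.base_le)]
    exact h.order ⟨_, hi⟩ ⟨_, hz⟩
  rw [Code.kind, Ex.eval_cond]
  simp only [Ex.holds_eq, hp, Ex.eval, h.c₁, h.mem, voterKind, dif_pos hi, CoalitionBribery.kind,
    dif_pos hz, Fin.val_inj]

theorem Holding.holds_mem {z : Ex} (hi : v 1 < I.n) :
    (Code.mem z).Holds N arr v ↔
      z.eval N arr v ∈ placed I.m (voterKind I (v 1)) (v 10) (v 11) (v 12) := by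
  by_cases hz : z.eval N arr v < I.m
  · simp only [Code.mem, Ex.holds_and, Ex.holds_or, Ex.holds_eq, Ex.holds_lt, h.eval_m,
      h.eval_kind (i := .var 1) hi hz, placed, mem_filter, mem_range]
    simp only [Ex.eval, or_assoc, Nat.pos_iff_ne_zero]
  · simp [Code.mem, h.eval_m, placed, hz]

theorem Holding.eval_size (hi : v 1 < I.n) :
    Code.size.eval N arr v = #(placed I.m (voterKind I (v 1)) (v 10) (v 11) (v 12)) := by
  rw [Code.size, Ex.eval_count]
  congr 1
  ext t
  rw [mem_filter, h.holds_mem (by simpa using hi), mem_range]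
  simp only [Ex.eval, Function.update_apply]
  norm_num
  intro ht
  have := mem_range.mp (mem_filter.mp ht).1
  exact this.trans (h.m_lt.trans_le h.base_le)

theorem Holding.eval_missing (hi : v 1 < I.n) (hc : v 13 ≤ I.m) :
    Code.missing.eval N arr v =
      #(range (v 13) \ placed I.m (voterKind I (v 1)) (v 10) (v 11) (v 12)) := by
  rw [Code.missing, Ex.eval_count]
  congr 1
  ext t
  have := h.m_lt.trans_le h.base_le
  rw [mem_filter, Ex.holds_and, Ex.holds_not, h.holds_mem (by simpa using hi), mem_sdiff, mem_range,
    mem_range, Ex.holds_lt]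
  simp only [Ex.eval, Function.update_apply]
  norm_num
  intro _ _
  omega

theorem Holding.holds_membersPlaced (hi : v 1 < I.n) (hc : v 13 ≤ I.m) :
    Code.membersPlaced.Holds N arr v ↔ ∀ z < v 13, voterKind I (v 1) z ≠ 0 →
      z ∈ placed I.m (voterKind I (v 1)) (v 10) (v 11) (v 12) := by
  have hN := h.m_lt.trans_le h.base_le
  rw [Code.membersPlaced, Ex.holds_not, Ex.holds_bmax]
  push Not
  refine forall_congr' fun t => ?_
  by_cases ht : t < v 13
  · have hk := h.eval_kind (v := Function.update v 7 t) (i := .var 1) (z := .var 7)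
      (by simpa [Ex.eval] using hi) (by simpa [Ex.eval] using (by omega : t < I.m))
    rw [Ex.holds_and, Ex.holds_and, Ex.holds_not, Ex.holds_not, h.holds_mem (by simpa using hi),
      Ex.holds_eq, Ex.holds_lt, hk]
    simp only [Ex.eval, Function.update_apply]
    norm_num [ht, (by omega : t < N)]
  · rw [Ex.holds_and, Ex.holds_and, Ex.holds_lt]
    simp only [Ex.eval, Function.update_apply]
    norm_num [ht]

/-- Division by counting: the quotient is the number of `t` with `M * (t + 1) ≤ v x`. As `v x < N`,
all such `t` lie in the range of the sum and the cap on `t + 1` is harmless. -/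
theorem Holding.eval_quot {x : ℕ} (hx : x ≠ 7) (hv : v x < N) :
    (Code.quot x).eval N arr v = v x / M := by
  have hM := h.base_pos
  rw [Code.quot, Ex.eval_count, ← card_range (v x / M)]
  congr 1
  ext t
  rw [mem_filter, Ex.holds_le, mem_range, mem_range]
  simp only [Ex.eval, h.eval_base, Function.update_self, Function.update_of_ne hx]
  rw [← Nat.succ_le_iff (n := v x / M), Nat.le_div_iff_mul_le hM]
  constructor
  · rintro ⟨h1, h2⟩
    rwa [min_eq_left h1, mul_comm] at h2
  · intro h2
    have h3 : t + 1 ≤ v x := (Nat.le_mul_of_pos_right _ hM).trans h2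
    refine ⟨by omega, ?_⟩
    rwa [min_eq_left (by omega), mul_comm]

theorem Holding.eval_pairs : Code.pairs.eval N arr v = I.m.choose 2 := by
  have hN := h.m_lt.trans_le h.base_le
  rw [Nat.choose_two_right, ← sum_range_id]
  change ∑ i ∈ range N, (Ex.cond _ _ _).eval N arr (Function.update v 7 i) = _
  simp only [Ex.eval_cond, Ex.holds_lt, h.eval_m]
  simp only [Ex.eval, Function.update_self]
  rw [← sum_filter]
  refine sum_congr ?_ fun _ _ => rfl
  ext t; simp; omega

end Eval

end CoalitionBribery

/-! ### The recursion for feasible states, as a condition on earlier table entries. -/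

namespace CoalitionBribery

open Finset RAM

theorem card_placed_lt {m : ℕ} {ty : ℕ → ℕ} {c : ℕ} (hc : c < m) (ht : ty c = 2) (x y : ℕ) :
    #(placed m ty x y 0) < m := by
  have : #(placed m ty x y 0) < #(range m) :=
    card_lt_card ⟨filter_subset _ _, fun h => by
      have := h (mem_range.mpr hc)
      simp [placed, ht] at this⟩
  simpa using this

/-- The rules read backwards. The inequalities in front of each recursive instance make its
subtractions exact, and `0 < b` in the last alternative makes that instance precede the current one
in the table. -/
theorem feas_iff {m : ℕ} {ty : ℕ → ℕ} {strict : Prop} {x y b a k : ℕ} :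
    Feas m ty strict x y b a k ↔ (x = 0 ∧ y = 0 ∧ b = 0 ∧ a = 0 ∧ k = 0) ∨
      (0 < x ∧ x ≤ m ∧ ty (x - 1) ≠ 1 ∧ Feas m ty strict (x - 1) y b a k) ∨
      (0 < y ∧ y ≤ m ∧ ty (y - 1) ≠ 0 ∧ Feas m ty strict x (y - 1) b a k) ∨
      (0 < x ∧ x ≤ m ∧ ty (x - 1) = 1 ∧ m - 1 - #(placed m ty (x - 1) y b) ≤ a ∧
        #(range (x - 1) \ placed m ty (x - 1) y b) ≤ k ∧
        Feas m ty strict (x - 1) y b (a - (m - 1 - #(placed m ty (x - 1) y b)))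
          (k - #(range (x - 1) \ placed m ty (x - 1) y b))) ∨
      (0 < y ∧ y ≤ m ∧ ty (y - 1) = 0 ∧
        (strict → ∀ z < y - 1, ty z ≠ 0 → z ∈ placed m ty x (y - 1) b) ∧
        #(range (y - 1) \ placed m ty x (y - 1) b) ≤ k ∧
        Feas m ty strict x (y - 1) b a (k - #(range (y - 1) \ placed m ty x (y - 1) b))) ∨
      (∃ c < m, ty c = 2 ∧ 0 < b ∧ b = m - #(placed m ty x y 0) ∧
        m - 1 - #(placed m ty x y 0) ≤ a ∧ #(range c \ placed m ty x y 0) ≤ k ∧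
        Feas m ty strict x y 0 (a - (m - 1 - #(placed m ty x y 0)))
          (k - #(range c \ placed m ty x y 0))) := by
  constructor
  · intro h
    cases h with
    | nil => simp
    | skipMember h1 h2 h3 => exact Or.inr (Or.inl ⟨by omega, h1, h2, h3⟩)
    | skipOther h1 h2 h3 => exact Or.inr (Or.inr (Or.inl ⟨by omega, h1, h2, h3⟩))
    | putMember h1 h2 h3 =>
      exact Or.inr (Or.inr (Or.inr (Or.inl ⟨by omega, h1, h2, Nat.le_add_left _ _,
        Nat.le_add_left _ _, by simpa using h3⟩)))
    | putOther h1 h2 h3 h4 =>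
      exact Or.inr (Or.inr (Or.inr (Or.inr (Or.inl ⟨by omega, h1, h2, h3,
        Nat.le_add_left _ _, by simpa using h4⟩))))
    | putPreferred c h1 h2 h3 =>
      refine Or.inr (Or.inr (Or.inr (Or.inr (Or.inr ⟨c, h1, h2, ?_, rfl, Nat.le_add_left _ _,
        Nat.le_add_left _ _, by simpa using h3⟩))))
      have := card_placed_lt h1 h2 x y
      omega
  · rintro (⟨rfl, rfl, rfl, rfl, rfl⟩ | ⟨h0, h1, h2, h3⟩ | ⟨h0, h1, h2, h3⟩ |
      ⟨h0, h1, h2, h3, h4, h5⟩ | ⟨h0, h1, h2, h3, h4, h5⟩ | ⟨c, h1, h2, h3, rfl, h4, h5, h6⟩)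
    · exact .nil
    · obtain ⟨x, rfl⟩ : ∃ x', x = x' + 1 := ⟨x - 1, by omega⟩
      exact .skipMember h1 h2 h3
    · obtain ⟨y, rfl⟩ : ∃ x', y = x' + 1 := ⟨y - 1, by omega⟩
      exact .skipOther h1 h2 h3
    · obtain ⟨x, rfl⟩ : ∃ x', x = x' + 1 := ⟨x - 1, by omega⟩
      simp only [Nat.add_sub_cancel] at *
      have := Feas.putMember h1 h2 h5
      rwa [Nat.sub_add_cancel h3, Nat.sub_add_cancel h4] at this
    · obtain ⟨y, rfl⟩ : ∃ x', y = x' + 1 := ⟨y - 1, by omega⟩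
      simp only [Nat.add_sub_cancel] at *
      have := Feas.putOther h1 h2 h3 h5
      rwa [Nat.sub_add_cancel h4] at this
    · have := Feas.putPreferred c h1 h2 h6
      rwa [Nat.sub_add_cancel h4, Nat.sub_add_cancel h5] at this

/-- The number with the given digits in base `M`. -/
def pack (M i x y b a k : ℕ) : ℕ := ((((i * M + x) * M + y) * M + b) * M + a) * M + k

theorem digit_lt {M p q r r' : ℕ} (h : p < q) (hr : r < M) : p * M + r < q * M + r' := by
  have : (p + 1) * M ≤ q * M := Nat.mul_le_mul_right _ h
  rw [add_mul] at this
  omega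

theorem div_digit {M p r : ℕ} (hr : r < M) : (p * M + r) / M = p := by
  rw [mul_comm, Nat.mul_add_div (by omega), Nat.div_eq_of_lt hr, add_zero]

theorem mod_digit {M p r : ℕ} (hr : r < M) : (p * M + r) % M = r := by
  rw [mul_comm, Nat.mul_add_mod, Nat.mod_eq_of_lt hr]

/-- Comparison of indices is lexicographic in the digits. The digits `x`, `y`, `b` come before `a`
and `k`, and every rule changes exactly one of these three, so its premise has a smaller index. -/
theorem pack_lt_of_x {M i x y b a k x' y' b' a' k' : ℕ} (hx : x' < x) (hy : y' < M) (hb : b' < M)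
    (ha : a' < M) (hk : k' < M) : pack M i x' y' b' a' k' < pack M i x y b a k :=
  digit_lt (digit_lt (digit_lt (digit_lt (by omega) hy) hb) ha) hk

theorem pack_lt_of_y {M i x y b a k y' b' a' k' : ℕ} (hy : y' < y) (hb : b' < M)
    (ha : a' < M) (hk : k' < M) : pack M i x y' b' a' k' < pack M i x y b a k :=
  digit_lt (digit_lt (digit_lt (by omega) hb) ha) hk

theorem pack_lt_of_b {M i x y b a k b' a' k' : ℕ} (hb : b' < b)
    (ha : a' < M) (hk : k' < M) : pack M i x y b' a' k' < pack M i x y b a k :=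
  digit_lt (digit_lt (by omega) ha) hk

namespace Code

/-- Evaluate a condition after a state has been stored in variables `10`, `11`, `12`, a place in
variable `13`, the points of the next place of the arrangement in variable `14`, and the number of
swaps of the party in place `13` in variable `15`. -/
def withState (x y b z e : Ex) : Ex :=
  .bind 10 x (.bind 11 y (.bind 12 b (.bind 13 z (.bind 14 (.sub (.sub m (.const 1)) size)
    (.bind 15 missing e)))))

/-- The predecessor of variable `x`. -/
def pred (x : ℕ) : Ex := .sub (.var x) (.const 1)

/-- The six conditions `nilStep`, `skipMember`, `skipOther`, `putMember`, `putOther` and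
`putPreferred` are the alternatives of `feas_iff` in order, with the recursive instances replaced by
table lookups. -/
def nilStep : Ex := ((Ex.var 2).eq (.const 0)).and (((Ex.var 3).eq (.const 0)).and
  (((Ex.var 4).eq (.const 0)).and (((Ex.var 5).eq (.const 0)).and ((Ex.var 6).eq (.const 0)))))

def skipMember : Ex := ((Ex.const 0).lt (.var 2)).and
  (((kind (.var 1) (pred 2)).eq (.const 1)).not.and
    (feas (.var 1) (pred 2) (.var 3) (.var 4) (.var 5) (.var 6)))

def skipOther : Ex := ((Ex.const 0).lt (.var 3)).and
  (((kind (.var 1) (pred 3)).eq (.const 0)).not.and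
    (feas (.var 1) (.var 2) (pred 3) (.var 4) (.var 5) (.var 6)))

/-- The entry of the table for the stored state and the points and swaps before it. -/
def before (a : Ex) : Ex :=
  feas (.var 1) (.var 10) (.var 11) (.var 12) a (.sub (.var 6) (.var 15))

def putMember : Ex := ((Ex.const 0).lt (.var 2)).and (withState (pred 2) (.var 3) (.var 4) (pred 2)
  (((kind (.var 1) (.var 13)).eq (.const 1)).and (((Ex.var 14).le (.var 5)).and
    (((Ex.var 15).le (.var 6)).and (before (.sub (.var 5) (.var 14)))))))

def putOther (strict : Bool) : Ex :=
  ((Ex.const 0).lt (.var 3)).and (withState (.var 2) (pred 3) (.var 4) (pred 3)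
    (((kind (.var 1) (.var 13)).eq (.const 0)).and
      ((if strict then membersPlaced else .const 1).and
        (((Ex.var 15).le (.var 6)).and (before (.var 5))))))

def putPreferred : Ex := .bmax 9 (((Ex.var 9).lt m).and (((Ex.const 0).lt (.var 4)).and
  (withState (.var 2) (.var 3) (.const 0) (.var 9)
    (((kind (.var 1) (.var 13)).eq (.const 2)).and (((Ex.var 4).eq (.sub m size)).and
      (((Ex.var 14).le (.var 5)).and (((Ex.var 15).le (.var 6)).and
        (before (.sub (.var 5) (.var 14))))))))))

/-- The entry of the table of feasible points, for the state in the variables `1`, …, `6`. -/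
def step (strict : Bool) : Ex :=
  ((Ex.var 1).lt n).and (((Ex.var 2).le m).and (((Ex.var 3).le m).and
    (nilStep.or (skipMember.or (skipOther.or (putMember.or ((putOther strict).or
      putPreferred)))))))

/-- The remainder of variable `x` that belongs to the quotient in variable `q`. -/
def remainder (x q : ℕ) : Ex := .sub (.var x) (.mul (.var q) base)

/-- The table of feasible points. -/
def feasTable (strict : Bool) : Ex :=
  .bind 21 (quot 0) (.bind 22 (quot 21) (.bind 23 (quot 22) (.bind 24 (quot 23) (.bind 1 (quot 24)
    (.bind 6 (remainder 0 21) (.bind 5 (remainder 21 22) (.bind 4 (remainder 22 23)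
      (.bind 3 (remainder 23 24) (.bind 2 (remainder 24 1)
        (.cond (step strict) (.const 1) (.const 0)))))))))))

end Code

section Step

variable {I : Base} {M N : ℕ} {arr : ℕ → ℕ → ℕ} (h : Holding I M N arr) {v : ℕ → ℕ}
include h

/-- Only variables from `10` on are bound, so the inputs below `10` survive. The hypotheses on `y`,
`b`, `z` hold for every environment agreeing with `v` there, because these expressions are evaluated
after some of the bindings. -/
theorem Holding.holds_withState {x y b z e : Ex} {X Y B Z : ℕ} {P : Prop} (hi : v 1 < I.n)
    (hx : x.eval N arr v = X)
    (hy : ∀ w : ℕ → ℕ, (∀ j < 10, w j = v j) → y.eval N arr w = Y)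
    (hb : ∀ w : ℕ → ℕ, (∀ j < 10, w j = v j) → b.eval N arr w = B)
    (hz : ∀ w : ℕ → ℕ, (∀ j < 10, w j = v j) → z.eval N arr w = Z) (hZ : Z ≤ I.m)
    (he : ∀ w : ℕ → ℕ, (∀ j < 10, w j = v j) → w 10 = X → w 11 = Y → w 12 = B → w 13 = Z →
      w 14 = I.m - 1 - #(placed I.m (voterKind I (v 1)) X Y B) →
      w 15 = #(range Z \ placed I.m (voterKind I (v 1)) X Y B) → (e.Holds N arr w ↔ P)) :
    (Code.withState x y b z e).Holds N arr v ↔ P := by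
  simp only [Code.withState, Ex.holds_bind]
  have upd : ∀ (w : ℕ → ℕ) (i c : ℕ), 10 ≤ i → (∀ j < 10, w j = v j) →
      ∀ j < 10, Function.update w i c j = v j := fun w i c hi hw j hj => by
    rw [Function.update_of_ne (by omega), hw j hj]
  rw [hx]
  have h1 := upd v 10 X le_rfl fun _ _ => rfl
  rw [hy _ h1]
  have h2 := upd _ 11 Y (by omega) h1
  rw [hb _ h2]
  have h3 := upd _ 12 B (by omega) h2
  rw [hz _ h3]
  have h4 := upd _ 13 Z (by omega) h3
  set w₀ := Function.update (Function.update (Function.update (Function.update v 10 X) 11 Y) 12 B)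
    13 Z with hw₀
  have e10 : w₀ 10 = X := by simp [hw₀]
  have e11 : w₀ 11 = Y := by simp [hw₀]
  have e12 : w₀ 12 = B := by simp [hw₀]
  have e13 : w₀ 13 = Z := by simp [hw₀]
  have e1 : w₀ 1 = v 1 := h4 1 (by omega)
  have hs : (Ex.sub (.sub Code.m (.const 1)) Code.size).eval N arr w₀ =
      I.m - 1 - #(placed I.m (voterKind I (v 1)) X Y B) := by
    simp only [Ex.eval, h.eval_m, h.eval_size (v := w₀) (by rw [e1]; exact hi), e1, e10, e11, e12]
  rw [hs]
  set w₁ := Function.update w₀ 14 _ with hw₁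
  have g : ∀ j, j ≠ 14 → w₁ j = w₀ j := fun j hj => Function.update_of_ne hj _ _
  rw [h.eval_missing (v := w₁) (by rw [g 1 (by omega), e1]; exact hi)
    (by rw [g 13 (by omega), e13]; exact hZ)]
  rw [g 1 (by omega), g 10 (by omega), g 11 (by omega), g 12 (by omega), g 13 (by omega), e1, e10,
    e11, e12, e13]
  refine he _ (upd _ 15 _ (by omega) (upd _ 14 _ (by omega) h4)) ?_ ?_ ?_ ?_ ?_ ?_
  · rw [Function.update_of_ne (by omega), g 10 (by omega), e10]
  · rw [Function.update_of_ne (by omega), g 11 (by omega), e11]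
  · rw [Function.update_of_ne (by omega), g 12 (by omega), e12]
  · rw [Function.update_of_ne (by omega), g 13 (by omega), e13]
  · rw [Function.update_of_ne (by omega), hw₁, Function.update_self]
  · rw [Function.update_self]

theorem Holding.holds_feas {i x y b a k : Ex} :
    (Code.feas i x y b a k).Holds N arr v ↔
      arr 4 (pack M (i.eval N arr v) (x.eval N arr v) (y.eval N arr v) (b.eval N arr v)
        (a.eval N arr v) (k.eval N arr v)) ≠ 0 := by
  simp only [Code.feas, Ex.Holds, Ex.eval, h.eval_digit, pack]

theorem Holding.holds_before {a : Ex} :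
    (Code.before a).Holds N arr v ↔
      arr 4 (pack M (v 1) (v 10) (v 11) (v 12) (a.eval N arr v) (v 6 - v 15)) ≠ 0 :=
  h.holds_feas

/-- If all relevant entries with smaller index are correct, the condition agrees with `feas_iff`
alternative by alternative; the `pack_lt` lemmas show that each lookup does go to a smaller index.
-/
theorem Holding.holds_step {strict : Bool}
    (hF : v 1 < I.n → ∀ x y b a k, x ≤ I.m → y ≤ I.m → b < M → a < M → k < M →
      pack M (v 1) x y b a k < pack M (v 1) (v 2) (v 3) (v 4) (v 5) (v 6) →
      (arr 4 (pack M (v 1) x y b a k) ≠ 0 ↔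
        Feas I.m (voterKind I (v 1)) (strict = true) x y b a k))
    (h4 : v 4 < M) (h5 : v 5 < M) (h6 : v 6 < M) :
    (Code.step strict).Holds N arr v ↔ v 1 < I.n ∧ v 2 ≤ I.m ∧ v 3 ≤ I.m ∧
      Feas I.m (voterKind I (v 1)) (strict = true) (v 2) (v 3) (v 4) (v 5) (v 6) := by
  simp only [Code.step, Ex.holds_and, Ex.holds_lt, Ex.holds_le, h.eval_m, h.eval_n]
  simp only [Ex.eval]
  refine and_congr_right fun hi => and_congr_right fun h2 => and_congr_right fun h3 => ?_
  specialize hF hi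
  have hm := I.two_le_m
  have hmM := h.m_lt
  have hmN := h.m_lt.trans_le h.base_le
  rw [feas_iff]
  simp only [Ex.holds_or]
  have hpred : ∀ (w : ℕ → ℕ) x, (Code.pred x).eval N arr w = w x - 1 := fun _ _ => rfl
  refine or_congr ?_ (or_congr ?_ (or_congr ?_ (or_congr ?_ (or_congr ?_ ?_))))
  · simp only [Code.nilStep, Ex.holds_and, Ex.holds_eq, Ex.eval]
  · simp only [Code.skipMember, Ex.holds_and, Ex.holds_not, Ex.holds_eq, Ex.holds_lt,
      h.holds_feas]
    rw [h.eval_kind (by exact hi) (by rw [hpred]; omega)]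
    simp only [Ex.eval, hpred]
    refine and_congr_right fun h0 => ?_
    rw [hF _ _ _ _ _ (by omega) h3 h4 h5 h6
      (pack_lt_of_x (by omega) (by omega) h4 h5 h6)]
    simp [h2]
  · simp only [Code.skipOther, Ex.holds_and, Ex.holds_not, Ex.holds_eq, Ex.holds_lt,
      h.holds_feas]
    rw [h.eval_kind (by exact hi) (by rw [hpred]; omega)]
    simp only [Ex.eval, hpred]
    refine and_congr_right fun h0 => ?_
    rw [hF _ _ _ _ _ h2 (by omega) h4 h5 h6 (pack_lt_of_y (by omega) h4 h5 h6)]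
    simp [h3]
  · rw [Code.putMember, Ex.holds_and, Ex.holds_lt]
    simp only [Ex.eval]
    refine and_congr_right fun h0 => ?_
    refine h.holds_withState (X := v 2 - 1) (Y := v 3) (B := v 4) (Z := v 2 - 1) hi rfl
      (fun w hw => hw 3 (by omega)) (fun w hw => hw 4 (by omega))
      (fun w hw => by rw [hpred, hw 2 (by omega)]) (by omega) ?_
    intro w hw e10 e11 e12 e13 e14 e15
    have e1 := hw 1 (by omega)
    have e5 := hw 5 (by omega)
    have e6 := hw 6 (by omega)
    simp only [Ex.holds_and, Ex.holds_eq, Ex.holds_le, h.holds_before]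
    rw [h.eval_kind (by simp only [Ex.eval]; omega) (by simp only [Ex.eval]; omega)]
    simp only [Ex.eval, e1, e5, e6, e10, e11, e12, e13, e14, e15]
    rw [hF _ _ _ _ _ (by omega) h3 h4 (by omega) (by omega)
      (pack_lt_of_x (by omega) (by omega) h4 (by omega) (by omega))]
    simp [h2]
  · rw [Code.putOther, Ex.holds_and, Ex.holds_lt]
    simp only [Ex.eval]
    refine and_congr_right fun h0 => ?_
    refine h.holds_withState (X := v 2) (Y := v 3 - 1) (B := v 4) (Z := v 3 - 1) hi rfl
      (fun w hw => by rw [hpred, hw 3 (by omega)]) (fun w hw => hw 4 (by omega))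
      (fun w hw => by rw [hpred, hw 3 (by omega)]) (by omega) ?_
    intro w hw e10 e11 e12 e13 e14 e15
    have e1 := hw 1 (by omega)
    have e5 := hw 5 (by omega)
    have e6 := hw 6 (by omega)
    have hst : (if strict then Code.membersPlaced else .const 1).Holds N arr w ↔
        (strict = true → ∀ z < v 3 - 1, voterKind I (v 1) z ≠ 0 →
          z ∈ placed I.m (voterKind I (v 1)) (v 2) (v 3 - 1) (v 4)) := by
      cases strict
      · simp [Ex.Holds, Ex.eval]
      · simp only [if_true, forall_const]
        rw [h.holds_membersPlaced (by omega) (by omega), e1, e10, e11, e12, e13]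
    simp only [Ex.holds_and, Ex.holds_eq, Ex.holds_le, h.holds_before, hst]
    rw [h.eval_kind (by simp only [Ex.eval]; omega) (by simp only [Ex.eval]; omega)]
    simp only [Ex.eval, e1, e5, e6, e10, e11, e12, e13, e15]
    rw [hF _ _ _ _ _ h2 (by omega) h4 (by omega) (by omega)
      (pack_lt_of_y (by omega) h4 (by omega) (by omega))]
    simp only [h3, true_and]
  · rw [Code.putPreferred, Ex.holds_bmax]
    have step : ∀ t < I.m, 0 < v 4 → ((Code.withState (.var 2) (.var 3) (.const 0) (.var 9)
        (((Code.kind (.var 1) (.var 13)).eq (.const 2)).and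
          (((Ex.var 4).eq (.sub Code.m Code.size)).and
            (((Ex.var 14).le (.var 5)).and (((Ex.var 15).le (.var 6)).and
              (Code.before (.sub (.var 5) (.var 14)))))))).Holds N arr (Function.update v 9 t) ↔
        voterKind I (v 1) t = 2 ∧ v 4 = I.m - #(placed I.m (voterKind I (v 1)) (v 2) (v 3) 0) ∧
        I.m - 1 - #(placed I.m (voterKind I (v 1)) (v 2) (v 3) 0) ≤ v 5 ∧
        #(range t \ placed I.m (voterKind I (v 1)) (v 2) (v 3) 0) ≤ v 6 ∧
        Feas I.m (voterKind I (v 1)) (strict = true) (v 2) (v 3) 0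
          (v 5 - (I.m - 1 - #(placed I.m (voterKind I (v 1)) (v 2) (v 3) 0)))
          (v 6 - #(range t \ placed I.m (voterKind I (v 1)) (v 2) (v 3) 0))) := by
      intro t ht hv4
      have hu : ∀ j, j ≠ 9 → Function.update v 9 t j = v j := fun j hj =>
        Function.update_of_ne hj _ _
      refine h.holds_withState (X := v 2) (Y := v 3) (B := 0) (Z := t)
        (by rw [hu 1 (by omega)]; exact hi) (hu 2 (by omega))
        (fun w hw => (hw 3 (by omega)).trans (hu 3 (by omega))) (fun w hw => rfl)
        (fun w hw => (hw 9 (by omega)).trans (Function.update_self _ _ _)) ht.le ?_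
      intro w hw e10 e11 e12 e13 e14 e15
      have e1 := (hw 1 (by omega)).trans (hu 1 (by omega))
      have e4 := (hw 4 (by omega)).trans (hu 4 (by omega))
      have e5 := (hw 5 (by omega)).trans (hu 5 (by omega))
      have e6 := (hw 6 (by omega)).trans (hu 6 (by omega))
      rw [hu 1 (by omega)] at e14 e15
      simp only [Ex.holds_and, Ex.holds_eq, Ex.holds_le, h.holds_before]
      rw [h.eval_kind (by simp only [Ex.eval]; omega) (by simp only [Ex.eval]; omega)]
      simp only [Ex.eval, h.eval_m, h.eval_size (v := w) (by rw [e1]; exact hi)]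
      simp only [e1, e4, e5, e6, e10, e11, e12, e13, e14, e15]
      rw [hF _ _ _ _ _ h2 h3 (by omega) (by omega) (by omega)
        (pack_lt_of_b hv4 (by omega) (by omega))]
    constructor
    · rintro ⟨t, -, ht⟩
      rw [Ex.holds_and, Ex.holds_and, Ex.holds_lt, Ex.holds_lt, h.eval_m] at ht
      simp only [Ex.eval, Function.update_self, Function.update_of_ne (by omega : 4 ≠ 9)] at ht
      obtain ⟨h7, h8, h9⟩ := ht
      rw [step t h7 h8] at h9
      exact ⟨t, h7, h9.1, h8, h9.2⟩
    · rintro ⟨t, ht, hk, h0, hr⟩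
      refine ⟨t, by omega, ?_⟩
      rw [Ex.holds_and, Ex.holds_and, Ex.holds_lt, Ex.holds_lt, h.eval_m, step t ht h0]
      simp only [Ex.eval, Function.update_self, Function.update_of_ne (by omega : 4 ≠ 9)]
      exact ⟨ht, h0, hk, hr⟩

end Step

end CoalitionBribery

/-! ### Correctness of the two tables and of the answer. -/

namespace CoalitionBribery

open Finset RAM

open Classical in
/-- Entry `j` of the table of feasible points. -/
noncomputable def feasEntry (I : Base) (M : ℕ) (strict : Prop) (j : ℕ) : ℕ :=
  if j / M / M / M / M / M < I.n ∧ j / M / M / M / M % M ≤ I.m ∧ j / M / M / M % M ≤ I.m ∧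
    Feas I.m (voterKind I (j / M / M / M / M / M)) strict (j / M / M / M / M % M)
      (j / M / M / M % M) (j / M / M % M) (j / M % M) (j % M) then 1 else 0

/-- Entry `j` of the table of the rests of the budget. -/
noncomputable def restEntry (I : Base) (M N : ℕ) (strict : Prop) (s : ℕ → ℕ → ℕ) (j : ℕ) : ℕ :=
  if j / M / M ≤ I.n then
    rest I.m (I.m.choose 2) N I.budget (voterKind I) strict s (j / M / M) (j / M % M) (j % M)
  else 0

open Classical in
theorem feasEntry_pack {I : Base} {M : ℕ} {strict : Prop} {i x y b a k : ℕ} (hi : i < I.n)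
    (hx : x ≤ I.m) (hy : y ≤ I.m) (hm : I.m < M) (hb : b < M) (ha : a < M) (hk : k < M) :
    feasEntry I M strict (pack M i x y b a k) ≠ 0 ↔
      Feas I.m (voterKind I i) strict x y b a k := by
  rw [feasEntry, pack]
  simp only [div_digit hk, mod_digit hk, div_digit ha, mod_digit ha, div_digit hb, mod_digit hb,
    div_digit (hy.trans_lt hm), mod_digit (hy.trans_lt hm), div_digit (hx.trans_lt hm),
    mod_digit (hx.trans_lt hm)]
  simp [hi, hx, hy]

theorem restEntry_pack {I : Base} {M N : ℕ} {strict : Prop} {s : ℕ → ℕ → ℕ} {i a b : ℕ}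
    (hi : i ≤ I.n) (hb : b < M) (ha : a < M) :
    restEntry I M N strict s ((i * M + a) * M + b) =
      rest I.m (I.m.choose 2) N I.budget (voterKind I) strict s i a b := by
  rw [restEntry]
  simp only [div_digit hb, mod_digit hb, div_digit ha, mod_digit ha, if_pos hi]

namespace Code

/-- The options for the last voter, with points in the variables `7` and `8`, swaps in `9`. -/
def option : Ex :=
  ((Ex.var 7).le (.var 2)).and (((Ex.var 8).le (.var 3)).and (((Ex.var 8).lt m).and
    (((Ex.var 9).le (.var 11)).and
      (feas (.var 10) m m (.add (.var 8) (.const 1)) (.var 7) (.var 9)))))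

/-- The table of the rests of the budget, for the price `price` of `9` swaps at voter `10`. -/
def restTable (price : Ex) : Ex :=
  .bind 21 (quot 0) (.bind 1 (quot 21) (.bind 3 (remainder 0 21) (.bind 2 (remainder 21 1)
    (.cond ((Ex.var 1).eq (.const 0))
      (.cond (((Ex.var 2).eq (.const 0)).and ((Ex.var 3).eq (.const 0)))
        (.add (.cell 0 (.const 2)) (.const 1)) (.const 0))
      (.cond ((Ex.var 1).le n)
        (.bind 10 (pred 1) (.bind 11 pairs (.bmax 7 (.bmax 8 (.bmax 9 (.cond option
          (.sub (rest (.var 10) (.sub (.var 2) (.var 7)) (.sub (.var 3) (.var 8))) price)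
          (.const 0)))))))
        (.const 0))))))

/-- The points in the variables `2` and `3` are affordable and meet the targets, where `11` holds
the number of all points. -/
def accepts : Ex :=
  ((Ex.var 2).lt base).and (((Ex.var 3).lt base).and
    (((Ex.const 0).lt (rest n (.var 2) (.var 3))).and
      (((Ex.mul (.cell 0 (.const 3)) (.var 11)).le (.mul (.cell 0 (.const 4)) (.var 2))).and
        ((Ex.mul (.cell 0 (.const 5)) (.var 2)).le (.mul (.cell 0 (.const 6)) (.var 3))))))

/-- The answer. -/
def answer : Ex :=
  .cond (.bind 11 (.mul n pairs) (.bmax 2 (.bmax 3 accepts))) (.const 1) (.const 0)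

end Code

section Tables

variable {I : Base} {M N : ℕ} {arr : ℕ → ℕ → ℕ} (h : Holding I M N arr)
include h

theorem Holding.eval_remainder {v : ℕ → ℕ} {x q : ℕ} (hq : v q = v x / M) :
    (Code.remainder x q).eval N arr v = v x % M := by
  simp only [Code.remainder, Ex.eval, h.eval_base, min_eq_left h.base_le, hq]
  rw [Nat.mod_def, mul_comm]

theorem Holding.eval_feasTable {strict : Bool} {j : ℕ} (hj : j < N)
    (hF : ∀ j' < j, arr 4 j' = feasEntry I M (strict = true) j') :
    (Code.feasTable strict).eval N arr (env j) = feasEntry I M (strict = true) j := by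
  have hM := h.base_pos
  have le1 : ∀ p, p / M ≤ p := fun p => Nat.div_le_self p M
  simp only [Code.feasTable, Ex.eval, env]
  rw [h.eval_quot (by omega) (by simpa using hj)]
  simp only [Function.update_self]
  rw [h.eval_quot (by omega) (by simpa using (le1 _).trans_lt hj)]
  simp only [Function.update_self]
  rw [h.eval_quot (by omega) (by simpa using ((le1 _).trans (le1 _)).trans_lt hj)]
  simp only [Function.update_self]
  rw [h.eval_quot (by omega) (by
    simpa using ((le1 _).trans ((le1 _).trans (le1 _))).trans_lt hj)]
  simp only [Function.update_self]
  rw [h.eval_quot (by omega) (by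
    simpa using ((le1 _).trans ((le1 _).trans ((le1 _).trans (le1 _)))).trans_lt hj)]
  simp only [Function.update_self]
  rw [h.eval_remainder (by simp)]
  rw [h.eval_remainder (by simp)]
  rw [h.eval_remainder (by simp)]
  rw [h.eval_remainder (by simp)]
  rw [h.eval_remainder (by simp)]
  set v : ℕ → ℕ := Function.update _ 2 _ with hv
  have v1 : v 1 = j / M / M / M / M / M := by simp [hv]
  have v2 : v 2 = j / M / M / M / M % M := by simp [hv]
  have v3 : v 3 = j / M / M / M % M := by simp [hv]
  have v4 : v 4 = j / M / M % M := by simp [hv]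
  have v5 : v 5 = j / M % M := by simp [hv]
  have v6 : v 6 = j % M := by simp [hv]
  -- Repeated division recovers the digits of `j`, so indices below that of the current state are
  -- exactly the entries already filled.
  have hpack : pack M (v 1) (v 2) (v 3) (v 4) (v 5) (v 6) = j := by
    rw [v1, v2, v3, v4, v5, v6, pack, Nat.div_add_mod', Nat.div_add_mod', Nat.div_add_mod',
      Nat.div_add_mod', Nat.div_add_mod']
  have hs := h.holds_step (v := v) (strict := strict) (by
    intro hi x y b a k hx hy hb ha hk hlt
    rw [hpack] at hlt
    rw [hF _ hlt, feasEntry_pack hi hx hy h.m_lt hb ha hk])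
    (by rw [v4]; exact Nat.mod_lt _ hM) (by rw [v5]; exact Nat.mod_lt _ hM)
    (by rw [v6]; exact Nat.mod_lt _ hM)
  rw [v1, v2, v3, v4, v5, v6] at hs
  rw [feasEntry]
  by_cases hc : (Code.step strict).Holds N arr v
  · rw [if_pos (hs.mp hc), if_neg hc]
  · rw [if_neg (mt hs.mpr hc), if_pos (by simpa [Ex.Holds] using hc)]

theorem Holding.eval_rest {v : ℕ → ℕ} {i a b : Ex} : (Code.rest i a b).eval N arr v =
    arr 5 ((i.eval N arr v * M + a.eval N arr v) * M + b.eval N arr v) := by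
  simp only [Code.rest, Ex.eval, h.eval_digit]

theorem Holding.holds_option {strict : Bool} {v : ℕ → ℕ}
    (hF : ∀ j < N, arr 4 j = feasEntry I M (strict = true) j) (h10 : v 10 < I.n) (h2 : v 2 < M)
    (h11 : v 11 = I.m.choose 2) :
    Code.option.Holds N arr v ↔ v 7 ≤ v 2 ∧ v 8 ≤ v 3 ∧ v 8 < I.m ∧ v 9 ≤ I.m.choose 2 ∧
      Feas I.m (voterKind I (v 10)) (strict = true) I.m I.m (v 8 + 1) (v 7) (v 9) := by
  simp only [Code.option, Ex.holds_and, Ex.holds_le, Ex.holds_lt, h.holds_feas, h.eval_m]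
  simp only [Ex.eval, h11]
  refine and_congr_right fun ha => and_congr_right fun _ => and_congr_right fun hb =>
    and_congr_right fun hk => ?_
  have hm := h.m_lt
  have hp := h.pairs_lt
  -- The leading digit is below `I.n < M` and the others are below `M`, so the index is below `M ^
  -- 6`.
  have hlt : pack M (v 10) I.m I.m (v 8 + 1) (v 7) (v 9) < N := by
    have h1 := h.n_lt
    have : pack M (v 10) I.m I.m (v 8 + 1) (v 7) (v 9) < pack M M 0 0 0 0 0 :=
      digit_lt (digit_lt (digit_lt (digit_lt (digit_lt (by omega) hm) hm) (by omega)) (by omega))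
        (by omega)
    refine this.trans_le (le_of_eq ?_)
    rw [← h.bound, pack]; ring
  rw [hF _ hlt, feasEntry_pack h10 le_rfl le_rfl hm (by omega) (by omega) (by omega)]

open Classical in
theorem Holding.eval_restTable {strict : Bool} {s : ℕ → ℕ → ℕ} {price : Ex} {j : ℕ} (hj : j < N)
    (hp : ∀ v : ℕ → ℕ, v 10 < I.n → v 9 ≤ I.m.choose 2 → v 11 = I.m.choose 2 →
      price.eval N arr v = s (v 10) (v 9))
    (hF : ∀ j < N, arr 4 j = feasEntry I M (strict = true) j)
    (hD : ∀ j' < j, arr 5 j' = restEntry I M N (strict = true) s j') :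
    (Code.restTable price).eval N arr (env j) = restEntry I M N (strict = true) s j := by
  have hM := h.base_pos
  have le1 : ∀ p, p / M ≤ p := fun p => Nat.div_le_self p M
  unfold Code.restTable
  rw [Ex.eval, Ex.eval, Ex.eval, Ex.eval]
  unfold env
  rw [h.eval_quot (by omega) (by simpa using hj)]
  simp only [Function.update_self]
  rw [h.eval_quot (by omega) (by simpa using (le1 _).trans_lt hj)]
  simp only [Function.update_self]
  rw [h.eval_remainder (by simp)]
  rw [h.eval_remainder (by simp)]
  set v : ℕ → ℕ := Function.update _ 2 _ with hv
  have v1 : v 1 = j / M / M := by simp [hv]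
  have v2 : v 2 = j / M % M := by simp [hv]
  have v3 : v 3 = j % M := by simp [hv]
  have hj' : (v 1 * M + v 2) * M + v 3 = j := by
    rw [v1, v2, v3, Nat.div_add_mod', Nat.div_add_mod']
  have l2 : v 2 < M := by rw [v2]; exact Nat.mod_lt _ hM
  have l3 : v 3 < M := by rw [v3]; exact Nat.mod_lt _ hM
  clear_value v
  rw [restEntry, ← v1, ← v2, ← v3, Ex.eval_cond, Ex.eval_cond, Ex.eval_cond]
  simp only [Ex.holds_eq, Ex.holds_and, Ex.holds_le, h.eval_n]
  by_cases h0 : v 1 = 0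
  · simp only [Ex.eval, h0, if_true, Nat.zero_le, rest, h.budget]
  have h0' : ¬ (Ex.var 1).eval N arr v = (Ex.const 0).eval N arr v := h0
  rw [if_neg h0']
  change (if v 1 ≤ I.n then _ else 0) = _
  refine if_ctx_congr Iff.rfl (fun h1 => ?_) fun _ => rfl
  obtain ⟨i, hi⟩ : ∃ i, v 1 = i + 1 := ⟨v 1 - 1, by omega⟩
  rw [hi, rest, Ex.eval, Ex.eval, h.eval_pairs, show (Code.pred 1).eval N arr v = i by
    simp [Code.pred, Ex.eval, hi]]
  rw [Ex.eval]
  refine sup_congr rfl fun a' _ => ?_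
  rw [Ex.eval]
  refine sup_congr rfl fun b' _ => ?_
  rw [Ex.eval]
  refine sup_congr rfl fun k _ => ?_
  set w : ℕ → ℕ := Function.update _ 9 _ with hw
  have w2 : w 2 = v 2 := by simp [hw]
  have w3 : w 3 = v 3 := by simp [hw]
  have w7 : w 7 = a' := by simp [hw]
  have w8 : w 8 = b' := by simp [hw]
  have w9 : w 9 = k := by simp [hw]
  have w10 : w 10 = i := by simp [hw]
  have w11 : w 11 = I.m.choose 2 := by simp [hw]
  clear_value w
  have ho := h.holds_option hF (v := w) (by omega) (by omega) w11
  rw [w2, w3, w7, w8, w9, w10] at ho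
  rw [Ex.eval_cond]
  refine if_ctx_congr ho (fun hc => ?_) fun _ => rfl
  rw [Ex.eval, h.eval_rest, hp w (by omega) (by omega) w11, w9, w10]
  simp only [Ex.eval, w2, w3, w7, w8, w10]
  -- The entry read belongs to one voter less, so its leading digit is smaller and it has been
  -- filled.
  rw [hD, restEntry_pack (by omega) (by omega) (by omega)]
  rw [← hj', hi]
  exact digit_lt (digit_lt (by omega) (by omega)) (by omega)

open Classical in
-- In each product the possibly huge numerator or denominator is the first factor. The second factor
-- is a number of points below `M`, hence at most `N`, and escapes the cap.
theorem Holding.eval_answer {strict : Bool} {s : ℕ → ℕ → ℕ} {v : ℕ → ℕ}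
    (hs : ∀ i < I.n, ∀ k k', k ≤ k' → k' ≤ I.m.choose 2 → s i k ≤ s i k')
    (hD : ∀ j < N, arr 5 j = restEntry I M N (strict = true) s j) :
    Code.answer.eval N arr v = if SwapCBP I (strict = true) s then 1 else 0 := by
  rw [Code.answer, Ex.eval_cond]
  refine if_congr ?_ rfl rfl
  rw [swapCBP_iff I _ s hs h.lt_base h.base_le, Ex.holds_bind]
  have hMN := h.base_le
  have hT : (Ex.mul Code.n Code.pairs).eval N arr v = I.n * I.m.choose 2 := by
    rw [Ex.eval, h.eval_n, h.eval_pairs, min_eq_left (h.pairs_lt.le.trans hMN)]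
  have key : ∀ a b w, w 2 = a → w 3 = b → w 11 = I.n * I.m.choose 2 →
      (Code.accepts.Holds N arr w ↔
      a < M ∧ b < M ∧ 0 < CoalitionBribery.rest I.m (I.m.choose 2) N I.budget (voterKind I)
        (strict = true) s I.n a b ∧
        I.φ.num.toNat * (I.n * I.m.choose 2) ≤ I.φ.den * a ∧
        I.ρ.num.toNat * a ≤ I.ρ.den * b) := by
    intro a b w w2 w3 w11
    simp only [Code.accepts, Ex.holds_and, Ex.holds_lt, Ex.holds_le, h.eval_base, h.eval_rest,
      h.eval_n]
    simp only [Ex.eval, w2, w3, w11, h.φ_num, h.φ_den, h.ρ_num, h.ρ_den,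
      min_eq_left (h.total_lt.le.trans hMN)]
    refine and_congr_right fun ha => and_congr_right fun hb => ?_
    rw [min_eq_left (ha.le.trans hMN), min_eq_left (hb.le.trans hMN), hD,
      restEntry_pack le_rfl hb ha]
    have h1 : (I.n * M + a) * M + b < (M * M + 0) * M + 0 :=
      digit_lt (digit_lt h.n_lt ha) hb
    refine h1.trans_le (le_trans (le_of_eq ?_) h.cube_le)
    ring
  rw [Ex.holds_bmax, hT]
  constructor
  · rintro ⟨a, -, ha⟩
    rw [Ex.holds_bmax] at ha
    obtain ⟨b, -, hb⟩ := ha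
    rw [key a b _ (by simp) (by simp) (by simp)]
      at hb
    exact ⟨a, hb.1, b, hb.2.1, hb.2.2⟩
  · rintro ⟨a, ha, b, hb, hr⟩
    refine ⟨a, by omega, ?_⟩
    rw [Ex.holds_bmax]
    refine ⟨b, by omega, ?_⟩
    rw [key a b _ (by simp) (by simp) (by simp)]
    exact ⟨ha, hb, hr⟩

end Tables

end CoalitionBribery

/-! ### Reading the encoded instance, and the running time. -/

namespace RAM

theorem eval_mono_nat (p : Polynomial ℕ) {x y : ℕ} (h : x ≤ y) : p.eval x ≤ p.eval y := by
  rw [Polynomial.eval_eq_sum_range, Polynomial.eval_eq_sum_range]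
  gcongr

theorem length_le_bitLength (w : List ℕ) : w.length ≤ bitLength w := by
  induction w with
  | nil => simp
  | cons k w ih =>
    simp only [bitLength, List.map_cons, List.sum_cons, List.length_cons] at ih ⊢
    omega

theorem getD_flatten {m : ℕ} (L : List (List ℕ)) (hL : ∀ l ∈ L, l.length = m) (w : List ℕ) {i r : ℕ}
    (hi : i < L.length) (hr : r < m) :
    (L.flatten ++ w).getD (i * m + r) 0 = (L.getD i []).getD r 0 := by
  induction L generalizing i with
  | nil => simp at hi
  | cons l L ih =>
    have hl := hL l (by simp)
    rw [List.flatten_cons, List.append_assoc]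
    cases i with
    | zero => rw [List.getD_append _ _ _ _ (by omega)]; simp
    | succ i =>
      rw [List.getD_append_right _ _ _ _ (by rw [hl, add_mul]; omega)]
      have : (i + 1) * m + r - l.length = i * m + r := by rw [hl, add_mul]; omega
      rw [this, ih (fun l' h' => hL l' (by simp [h'])) (by simpa using hi)]
      simp

theorem getD_flatten_ofFn {m n : ℕ} (f : Fin n → Fin m → ℕ) (w : List ℕ) (i : Fin n) (r : Fin m) :
    ((List.ofFn fun i => List.ofFn (f i)).flatten ++ w).getD (i * m + r) 0 = f i r := by
  rw [getD_flatten _ (by simp [List.mem_ofFn]) _ (by simp) r.isLt]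
  simp [List.getD]

end RAM

namespace CoalitionBribery

open Finset RAM

theorem length_flatten_orders (I : Base) : (List.ofFn fun i : Fin I.n =>
    List.ofFn fun r : Fin I.m => (((I.orders i).symm r : Fin I.m) : ℕ)).flatten.length =
      I.n * I.m := by
  simp [List.length_flatten, List.map_ofFn, Function.comp_def]

theorem length_encode (I : Base) : I.encode.length = 8 + I.m + I.n * I.m := by
  rw [Base.encode, List.length_append, List.length_append, length_flatten_orders]
  simp

theorem getD_encode_append (I : Base) (w : List ℕ) (t : ℕ) :
    (I.encode ++ w).getD (8 + I.m + I.n * I.m + t) 0 = w.getD t 0 := by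
  rw [List.getD_append_right _ _ _ _ (by rw [length_encode]; omega), length_encode]
  congr 1
  omega

theorem holding_of_encode (I : Base) (w : List ℕ) {N₀ : ℕ} {arr : ℕ → ℕ → ℕ}
    (hN : I.encode.length ≤ N₀) (h0 : ∀ t, arr 0 t = (I.encode ++ w).getD t 0)
    (h1 : arr 1 0 = N₀ ^ 3) : Holding I (N₀ ^ 3) (N₀ ^ 18) arr := by
  have hrw : I.encode ++ w = [I.m, I.n, I.budget, I.φ.num.toNat, I.φ.den, I.ρ.num.toNat, I.ρ.den,
      (I.c₁ : ℕ)] ++ (List.ofFn (fun c : Fin I.m => if c ∈ I.A then 1 else 0) ++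
      ((List.ofFn fun i : Fin I.n => List.ofFn fun r : Fin I.m =>
        (((I.orders i).symm r : Fin I.m) : ℕ)).flatten ++ w)) := by
    simp [Base.encode]
  rw [length_encode] at hN
  refine ⟨?_, ?_, ?_, ?_, ?_, ?_, ?_, ?_, fun c => ?_, fun i r => ?_, h1, ?_, ?_⟩
  iterate 8 rw [h0, hrw]; rfl
  · rw [h0, hrw, List.getD_append_right _ _ _ _ (by simp), List.getD_append _ _ _ _ (by simp)]
    simp [List.getD]
  · have h2 : 8 + I.m + (i : ℕ) * I.m + r - 8 - I.m = i * I.m + r := by omega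
    rw [h0, hrw, List.getD_append_right _ _ _ _ (by simp; omega),
      List.getD_append_right _ _ _ _ (by simp; omega)]
    simp only [List.length_cons, List.length_nil, List.length_ofFn, Nat.reduceAdd, h2]
    exact getD_flatten_ofFn (fun i r => (((I.orders i).symm r : Fin I.m) : ℕ)) w i r
  -- The input lists `I.n * I.m` places of the orders and `I.m` coalition indicators, so both
  -- numbers are at most `N₀`, and `N₀ ^ 2 < N₀ ^ 3`.
  · calc I.n * (I.m * I.m) = I.n * I.m * I.m := by ring
      _ ≤ N₀ * N₀ := Nat.mul_le_mul (by omega) (by omega)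
      _ < N₀ * N₀ * N₀ := lt_mul_of_one_lt_right (Nat.mul_pos (by omega) (by omega)) (by omega)
      _ = N₀ ^ 3 := by ring
  · rw [← pow_mul]

/-- The algorithm. -/
def solver (strict : Bool) (price : Ex) : Prog :=
  .seq (fill 1 (Ex.boundPow 3)) (.seq (assignBound (Ex.boundPow 18))
    (.seq (fill 4 (Code.feasTable strict)) (.seq (fill 5 (Code.restTable price))
      (assignBound Code.answer))))

/-- Bound for the running time of the algorithm. -/
noncomputable def solverTime (strict : Bool) (price : Ex) : Polynomial ℕ :=
  loopTime ((Ex.boundPow 3).time + 3) + ((Ex.boundPow 18).time + 2) +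
    (loopTime ((Code.feasTable strict).time + 3) + loopTime ((Code.restTable price).time + 3) +
      (Code.answer.time + 2)).comp (Polynomial.X ^ 18)

/-- The first two phases run with loop bound `N₀`, the length of the input, or less than
polynomially more time; the others run with bound `N₀ ^ 18`, whence the composition with `X ^ 18`.
The price enters only through an expression whose value is `s` for voter `v 10` and `v 9` swaps. -/
theorem run_solver (strict : Bool) (price : Ex) (I : Base) (w : List ℕ) (s : ℕ → ℕ → ℕ)
    (hs : ∀ i < I.n, ∀ k k', k ≤ k' → k' ≤ I.m.choose 2 → s i k ≤ s i k')
    (hp : ∀ M N arr, Holding I M N arr → (∀ t, arr 0 t = (I.encode ++ w).getD t 0) →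
      ∀ v : ℕ → ℕ, v 10 < I.n → v 9 ≤ I.m.choose 2 → v 11 = I.m.choose 2 →
        price.eval N arr v = s (v 10) (v 9)) :
    ∃ t σ, Run (solver strict price) (Memory.init (I.encode ++ w)) t σ ∧
      t ≤ (solverTime strict price).eval (bitLength (I.encode ++ w)) ∧
      (SwapCBP I (strict = true) s → σ.reg 0 = 1) ∧ (¬ SwapCBP I (strict = true) s → σ.reg 0 = 0) := by
  classical
  set N₀ := (I.encode ++ w).length with hN₀
  have hlen : I.encode.length ≤ N₀ := by simp [hN₀]
  have hpos : 0 < N₀ := by rw [length_encode] at hlen; omega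
  obtain ⟨t₁, σ₁, r₁, l₁, n₁, o₁, a₁, f₁⟩ := run_fill (a := 1) (e := Ex.boundPow 3)
    (fun _ => N₀ ^ 3) (Memory.init (I.encode ++ w)) (N := N₀) (by simp [Memory.init, hN₀])
    (by simp [Memory.init]) (fun j _ arr _ _ => Ex.eval_boundPow _ _ _ _)
  -- From here on register `0` holds the larger bound; the base `N₀ ^ 3` had to be stored in array
  -- `1` before.
  obtain ⟨t₂, σ₂, r₂, l₂, n₂, o₂, a₂⟩ := run_assignBound (Ex.boundPow 18) σ₁ n₁ o₁
  rw [Ex.eval_boundPow] at n₂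
  have hold : ∀ arr : ℕ → ℕ → ℕ, arr 0 = σ₁.arr 0 → arr 1 = σ₁.arr 1 →
      Holding I (N₀ ^ 3) (N₀ ^ 18) arr ∧ ∀ t, arr 0 t = (I.encode ++ w).getD t 0 := by
    intro arr h0 h1
    have h0' : ∀ t, arr 0 t = (I.encode ++ w).getD t 0 := fun t => by
      rw [h0, a₁ 0 (by omega)]; simp [Memory.init]
    exact ⟨holding_of_encode I w hlen h0' (by rw [h1, f₁ 0 hpos]), h0'⟩
  obtain ⟨t₃, σ₃, r₃, l₃, n₃, o₃, a₃, f₃⟩ := run_fill (a := 4) (e := Code.feasTable strict)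
    (feasEntry I (N₀ ^ 3) (strict = true)) σ₂ n₂ o₂ (fun j hj arr h h' =>
      (hold arr (by rw [h 0 (by omega), a₂]) (by rw [h 1 (by omega), a₂])).1.eval_feasTable hj h')
  obtain ⟨t₄, σ₄, r₄, l₄, n₄, o₄, a₄, f₄⟩ := run_fill (a := 5) (e := Code.restTable price)
    (restEntry I (N₀ ^ 3) (N₀ ^ 18) (strict = true) s) σ₃ n₃ o₃ (fun j hj arr h h' => by
      obtain ⟨hH, h0⟩ := hold arr (by rw [h 0 (by omega), a₃ 0 (by omega), a₂])
        (by rw [h 1 (by omega), a₃ 1 (by omega), a₂])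
      exact hH.eval_restTable hj (hp _ _ _ hH h0) (by rw [h 4 (by omega)]; exact f₃) h')
  obtain ⟨t₅, σ₅, r₅, l₅, n₅, -, -⟩ := run_assignBound Code.answer σ₄ n₄ o₄
  have hH := (hold σ₄.arr (by rw [a₄ 0 (by omega), a₃ 0 (by omega), a₂])
    (by rw [a₄ 1 (by omega), a₃ 1 (by omega), a₂])).1
  rw [hH.eval_answer hs f₄] at n₅
  refine ⟨_, σ₅, Run.seq r₁ (Run.seq r₂ (Run.seq r₃ (Run.seq r₄ r₅))), ?_,
    fun h => by rw [n₅, if_pos h], fun h => by rw [n₅, if_neg h]⟩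
  refine le_trans ?_ (eval_mono_nat (solverTime strict price) (length_le_bitLength _))
  rw [← hN₀]
  simp only [solverTime, Polynomial.eval_add, Polynomial.eval_comp, Polynomial.eval_pow,
    Polynomial.eval_X] at *
  omega

/-! ### The prices of the three bribery types. -/

theorem card_swapped_eq_zero {m : ℕ} {O O' : Pref m} : #(swapped O O') = 0 ↔ O' = O := by
  constructor
  · intro h
    rw [card_eq_zero] at h
    -- Without inversions, the map from old to new places is strictly increasing on `Fin m`, hence
    -- the identity.
    have hmono : StrictMono fun r => O' (O.symm r) := by
      intro r r' hr
      have : (O.symm r, O.symm r') ∉ swapped O O' := by rw [h]; exact notMem_empty _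
      rw [mem_swapped] at this
      simp only [Equiv.apply_symm_apply, not_and, not_lt] at this
      refine lt_of_le_of_ne (this hr) fun e => hr.ne ?_
      simpa using e
    have hid : (fun r => O' (O.symm r)) = id := hmono.eq_id
    ext c
    have := congrFun hid (O c)
    simp only [Equiv.symm_apply_apply, id] at this
    rw [this]
  · rintro rfl
    rw [card_eq_zero, eq_empty_iff_forall_notMem]
    intro q hq
    rw [mem_swapped] at hq
    exact lt_asymm hq.1 hq.2

theorem oneBordaCBP_solvable : SolvableInPolyTime Base.encode OneBordaCBP := by
  refine ⟨solver false (.cond (.var 9) (.const 1) (.const 0)),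
    solverTime false (.cond (.var 9) (.const 1) (.const 0)), fun I => ?_⟩
  obtain ⟨t, σ, hr, ht, h0⟩ := run_solver false (.cond (.var 9) (.const 1) (.const 0)) I []
    (fun _ k => if k = 0 then 0 else 1) (fun i _ k k' h _ => by split_ifs <;> omega)
    (fun M N arr _ _ v _ _ _ => rfl)
  rw [List.append_nil] at hr ht
  have hiff : OneBordaCBP I ↔ _ := cbp_iff_swapCBP I (false = true)
    (fun _ k => if k = 0 then 0 else 1) _ _ (by simp)
    (by simp only [card_swapped_eq_zero, implies_true])
  rw [hiff]
  exact ⟨t, σ, hr, ht, h0⟩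

theorem dollarBordaCBP_solvable : SolvableInPolyTime DollarInstance.encode DollarBordaCBP := by
  -- The base encoding has length `8 + m + n * m`, so the price of voter `10` stands at that offset
  -- plus its number.
  set pr : Ex := .cond (.var 9)
    (.cell 0 (.add (.add (.add (.const 8) Code.m) (.mul Code.n Code.m)) (.var 10))) (.const 0)
    with hpr
  refine ⟨solver false pr, solverTime false pr, fun I => ?_⟩
  set s : ℕ → ℕ → ℕ := fun i k => if k = 0 then 0 else if h : i < I.n then I.price ⟨i, h⟩ else 0
    with hs
  obtain ⟨t, σ, hr, ht, h0⟩ := run_solver false pr I.toBase (List.ofFn I.price) s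
    (fun i _ k k' h _ => by
      by_cases hk : k = 0
      · simp [hs, hk]
      · have hk' : k' ≠ 0 := by omega
        simp only [hs, if_neg hk, if_neg hk', le_refl])
    (fun M N arr hH h0 v h10 _ _ => by
      simp only [hpr, Ex.eval, hH.eval_m, hH.eval_n, hs, min_eq_left (hH.m_lt.le.trans hH.base_le),
        dif_pos h10]
      rw [h0, getD_encode_append]
      simp [List.getD, h10])
  have hiff : DollarBordaCBP I ↔ _ := cbp_iff_swapCBP I.toBase (false = true) s _ _ (by simp)
    (fun i O' => by simp only [hs, card_swapped_eq_zero, i.isLt, dif_pos])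
  rw [hiff]
  exact ⟨t, σ, hr, ht, h0⟩

theorem shiftBordaCBP_solvable : SolvableInPolyTime ShiftInstance.encode ShiftBordaCBP := by
  -- The price lists follow the base encoding as rows of length `m.choose 2 + 1`; variable `11`
  -- holds `m.choose 2`.
  set pr : Ex := .cell 0 (.add (.add (.add (.const 8) Code.m) (.mul Code.n Code.m))
    (.add (.mul (.var 10) (.add (.var 11) (.const 1))) (.var 9))) with hpr
  refine ⟨solver true pr, solverTime true pr, fun I => ?_⟩
  set s : ℕ → ℕ → ℕ := fun i k =>
    if h : i < I.n ∧ k < I.m.choose 2 + 1 then I.shiftPrice ⟨i, h.1⟩ ⟨k, h.2⟩ else 0 with hs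
  obtain ⟨t, σ, hr, ht, h0⟩ := run_solver true pr I.toBase
    (List.ofFn fun i : Fin I.n => List.ofFn (I.shiftPrice i)).flatten s
    (fun i hi k k' h hk => by
      simp only [hs, hi, (by omega : k < I.m.choose 2 + 1), (by omega : k' < I.m.choose 2 + 1),
        and_self, dif_pos]
      exact I.shiftPrice_mono _ h)
    (fun M N arr hH h0 v h10 h9 h11 => by
      have := hH.pairs_lt
      have := hH.base_le
      simp only [hpr, Ex.eval, hH.eval_m, hH.eval_n, hs, min_eq_left (hH.m_lt.le.trans hH.base_le),
        h11, min_eq_left (by omega : I.m.choose 2 + 1 ≤ N)]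
      rw [h0, getD_encode_append, dif_pos ⟨h10, by omega⟩]
      have := getD_flatten_ofFn I.shiftPrice [] ⟨v 10, h10⟩ ⟨v 9, by omega⟩
      rwa [List.append_nil] at this)
  have hiff : ShiftBordaCBP I ↔ _ := cbp_iff_swapCBP I.toBase (true = true) s _ _
    (fun i O' => ⟨fun h _ => h, fun h => h rfl⟩)
    (fun i O' => by
      simp only [hs, i.isLt, Nat.lt_succ_of_le (card_swapped_le (I.orders i) O'), and_self, dif_pos])
  rw [hiff]
  exact ⟨t, σ, hr, ht, h0⟩

end CoalitionBribery

theorem mainTheorem4 :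
    RAM.SolvableInPolyTime CoalitionBribery.Base.encode CoalitionBribery.OneBordaCBP ∧
    RAM.SolvableInPolyTime CoalitionBribery.DollarInstance.encode
      CoalitionBribery.DollarBordaCBP ∧
    RAM.SolvableInPolyTime CoalitionBribery.ShiftInstance.encode
      CoalitionBribery.ShiftBordaCBP :=
  ⟨CoalitionBribery.oneBordaCBP_solvable, CoalitionBribery.dollarBordaCBP_solvable,
    CoalitionBribery.shiftBordaCBP_solvable⟩
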